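/- Let $(M,d)$ be a complete metric space and $\mathbf m$ a Radon measure on $M$ that is finite on bounded sets. For a Lipschitz function $f:M\to\mathbb R$ let $\operatorname{lip} f(x)=\limsup_{y\to x,\,y\ne x}\frac{|f(y)-f(x)|}{d(y,x)}$ (equal to $0$ at isolated points). For $p\in(1,\infty)$ let $D_p^{\operatorname{lip}}$ be the set of Lipschitz functions $f$ with $\operatorname{lip} f\in L^p(\mathbf m)$, and let $D_p\subset L^0(\mathbf m)$ be the set of those $f$ for which $$\inf\Big\{\liminf_{n\to\infty}\int(\operatorname{lip} f_n)^p\,d\mathbf m \;:\; f_n\in D_p^{\operatorname{lip}},\ f_n\to f \text{ in } L^0(\mathbf m)\Big\}<\infty ,$$ where convergence in $L^0(\mathbf m)$ is convergence in measure on sets of finite measure. For $f\in D_p$ the relaxed slope $|Df|_{*,p}\in L^p(\mathbf m)$ is the ($\mathbf m$-a.e.) greatest $G\in L^p(\mathbf m)$ such that $G\le \tilde G$ $\mathbf m$-a.e. whenever $f_n\in D_p^{\operatorname{lip}}$, $f_n\to f$ in $L^0(\mathbf m)$ and $\operatorname{lip} f_n\rightharpoonup\tilde G$ weakly in $L^p(\mathbf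 m)$. It is subadditive and absolutely homogeneous on the linear space $D_p$. The $L^p$-cotangent module $L^p(T^*M)$ is the Banach space obtained as the completion, after dividing out the elements of norm $0$, of the space of all families $s=(f_i,A_i)_{i\in\mathbb N}$ with $(A_i)$ a Borel partition of $M$, $f_i\in D_p$ and $\|s\|^p=\sum_i\int_{A_i}|Df_i|_{*,p}^p\,d\mathbf m<\infty$, with the vector space operations taken pointwise on common refinements of the partitions. The Cheeger energy is $E(f)=\int|Df|_{*,2}^2\,d\mathbf m$ for $f\in D_2$ and $E(f)=\infty$ for $f\in L^0(\mathbf m)\setminus D_2$. **Proposition.** Suppose that $(M,d,\mathbf m)$ is infinitesimally Riemannian, i.e. for all Lipschitz functions $f,g:M\to\mathbb R$ $$(\operatorname{lip}(f+g))^2+(\operatorname{lip}(f-g))^2=2(\operatorname{lip} f)^2+2(\operatorname{lip} g)^2\qquad \mathbf m\text{-a.e.}$$ Then $(M,d,\mathbf m)$ is infinitesimally Hilbertian, i.e. the Cheeger energy is a quadratic form: $E(f+g)+E(f-g)=2E(f)+2E(g)$ and $E(cf)=c^2E(f)$ for all $f,g\in L^0(\mathbf m)$, $c\in\mathbb R$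 (with $0\cdot\infty=0$). Moreover, $L^p(T^*M)$ is reflexive for every $p\in(1,\infty)$. -/

import Mathlib

open MeasureTheory Filter Topology Set
open scoped ENNReal NNReal

noncomputable section

namespace MetricSobolev

/-! ### The local Lipschitz constant -/

section Lip

variable {M : Type*} [MetricSpace M]

/-- The local Lipschitz constant (slope) of `f` at `x`, that is the upper limit of
`|f y - f x| / d(y, x)` as `y → x` with `y ≠ x`; it is `0` at isolated points. -/
def lip (f : M → ℝ) (x : M) : ℝ :=
  limsup (fun y => |f y - f x| / dist y x) (𝓝[≠] x)

/-- `f` is a (globally) Lipschitz function. -/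
def IsLip (f : M → ℝ) : Prop := ∃ K : ℝ≥0, LipschitzWith K f

theorem IsLip.add {f g : M → ℝ} (hf : IsLip f) (hg : IsLip g) : IsLip (f + g) := by
  obtain ⟨K, hK⟩ := hf
  obtain ⟨L, hL⟩ := hg
  exact ⟨K + L, hK.add hL⟩

theorem IsLip.smul {f : M → ℝ} (hf : IsLip f) (c : ℝ) : IsLip (c • f) := by
  obtain ⟨K, hK⟩ := hf
  refine ⟨‖c‖₊ * K, LipschitzWith.of_dist_le_mul fun x y => ?_⟩
  have := hK.dist_le_mul x y
  simp only [Pi.smul_apply, dist_smul₀, NNReal.coe_mul, coe_nnnorm, mul_assoc]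
  gcongr

theorem IsLip.continuous {f : M → ℝ} (hf : IsLip f) : Continuous f :=
  hf.choose_spec.continuous

theorem IsLip.bdd {f : M → ℝ} (hf : IsLip f) (x : M) :
    (𝓝[≠] x).IsBoundedUnder (· ≤ ·) (fun y => |f y - f x| / dist y x) := by
  obtain ⟨K, hK⟩ := hf
  refine isBoundedUnder_of ⟨K, fun y => ?_⟩
  have := hK.dist_le_mul y x
  rw [Real.dist_eq] at this
  exact div_le_of_le_mul₀ dist_nonneg K.2 this

theorem lip_of_bot (f : M → ℝ) {x : M} (h : 𝓝[≠] x = ⊥) : lip f x = 0 := by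
  simp [lip, h, limsup, limsSup]

theorem IsLip.eventually_lt {f : M → ℝ} (hf : IsLip f) {x : M} {c : ℝ} (h : lip f x < c) :
    ∀ᶠ y in 𝓝[≠] x, |f y - f x| / dist y x < c :=
  eventually_lt_of_limsup_lt h (hf.bdd x)

theorem lip_le_of_eventually {f : M → ℝ} {x : M} {c : ℝ} (hc : 0 ≤ c)
    (h : ∀ᶠ y in 𝓝[≠] x, |f y - f x| / dist y x ≤ c) : lip f x ≤ c := by
  rcases eq_or_neBot (𝓝[≠] x) with hb | hb
  · rwa [lip_of_bot f hb]
  · refine limsup_le_of_le ?_ h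
    exact IsCoboundedUnder.of_frequently_ge (a := 0)
      (Eventually.frequently (Eventually.of_forall fun y => by positivity))

theorem IsLip.lip_nonneg {f : M → ℝ} (hf : IsLip f) (x : M) : 0 ≤ lip f x := by
  rcases eq_or_neBot (𝓝[≠] x) with hb | hb
  · rw [lip_of_bot f hb]
  · refine le_limsup_of_frequently_le (Eventually.frequently
      (Eventually.of_forall fun y => by positivity)) (hf.bdd x)

theorem lip_add_le {f g : M → ℝ} (hf : IsLip f) (hg : IsLip g) (x : M) :
    lip (f + g) x ≤ lip f x + lip g x := by
  refine le_of_forall_pos_le_add fun ε hε => ?_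
  have h1 := hf.eventually_lt (x := x) (c := lip f x + ε / 2) (by linarith)
  have h2 := hg.eventually_lt (x := x) (c := lip g x + ε / 2) (by linarith)
  have h3 := hf.lip_nonneg x
  have h4 := hg.lip_nonneg x
  refine lip_le_of_eventually (by linarith) ?_
  filter_upwards [h1, h2] with y hy1 hy2
  have : |(f + g) y - (f + g) x| / dist y x
      ≤ |f y - f x| / dist y x + |g y - g x| / dist y x := by
    rw [← add_div]
    gcongr
    simp only [Pi.add_apply]
    rw [add_sub_add_comm]
    exact abs_add_le _ _
  linarith

theorem lip_smul_le {f : M → ℝ} (hf : IsLip f) (c : ℝ) (x : M) :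
    lip (c • f) x ≤ |c| * lip f x := by
  have h3 := hf.lip_nonneg x
  have key : ∀ ε > 0, lip (c • f) x ≤ |c| * (lip f x + ε) := by
    intro ε hε
    refine lip_le_of_eventually (by positivity) ?_
    filter_upwards [hf.eventually_lt (x := x) (c := lip f x + ε) (by linarith)] with y hy
    have : |(c • f) y - (c • f) x| / dist y x = |c| * (|f y - f x| / dist y x) := by
      simp only [Pi.smul_apply, smul_eq_mul, ← mul_sub, abs_mul, mul_div_assoc]
    rw [this]
    gcongr
  have ht : Tendsto (fun ε : ℝ => |c| * (lip f x + ε)) (𝓝[>] 0) (𝓝 (|c| * (lip f x + 0))) :=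
    Tendsto.mono_left (Continuous.tendsto (by fun_prop) 0) nhdsWithin_le_nhds
  rw [add_zero] at ht
  exact ge_of_tendsto ht (eventually_mem_nhdsWithin.mono fun ε hε => key ε hε)

theorem lip_smul {f : M → ℝ} (hf : IsLip f) (c : ℝ) (x : M) :
    lip (c • f) x = |c| * lip f x := by
  refine le_antisymm (lip_smul_le hf c x) ?_
  rcases eq_or_ne c 0 with rfl | hc
  · simpa using (hf.smul 0).lip_nonneg x
  · have := lip_smul_le (hf.smul c) c⁻¹ x
    rw [smul_smul, inv_mul_cancel₀ hc, one_smul, abs_inv] at this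
    rwa [inv_mul_eq_div, le_div_iff₀' (abs_pos.2 hc)] at this

theorem IsLip.measurable_lip [MeasurableSpace M] [BorelSpace M] {f : M → ℝ} (hf : IsLip f) :
    Measurable (lip f) := by
  refine measurable_of_Iio fun a => ?_
  have : lip f ⁻¹' Iio a = ⋃ b : ℚ, ⋃ (_ : (b : ℝ) < a ∧ 0 ≤ (b : ℝ)), ⋃ n : ℕ,
      ⋂ y : M, {x | 1 / ((n : ℝ) + 1) ≤ dist y x} ∪ {x | |f y - f x| ≤ b * dist y x} := by
    ext x
    simp only [mem_preimage, mem_Iio, mem_iUnion, mem_iInter, mem_union, mem_ofPred_eq,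
      exists_prop]
    constructor
    · intro hx
      obtain ⟨b, hb1, hb2⟩ := exists_rat_btwn hx
      refine ⟨b, ⟨hb2, (hf.lip_nonneg x).trans hb1.le⟩, ?_⟩
      have h := hf.eventually_lt hb1
      rw [eventually_nhdsWithin_iff, Metric.eventually_nhds_iff] at h
      obtain ⟨ε, hε, h⟩ := h
      obtain ⟨n, hn⟩ := exists_nat_one_div_lt hε
      refine ⟨n, fun y => ?_⟩
      by_cases hy : dist y x < ε
      · right
        by_cases hyx : y = x
        · simp [hyx]
        · have h2 := h hy hyx
          rw [div_lt_iff₀ (dist_pos.2 hyx)] at h2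
          exact h2.le
      · left; linarith
    · rintro ⟨b, ⟨hb, hb0⟩, n, h⟩
      refine lt_of_le_of_lt (lip_le_of_eventually hb0 ?_) hb
      rw [eventually_nhdsWithin_iff, Metric.eventually_nhds_iff]
      refine ⟨1 / ((n : ℝ) + 1), by positivity, fun y hy hyx => ?_⟩
      rcases h y with h | h
      · linarith
      · exact div_le_of_le_mul₀ dist_nonneg hb0 h
  rw [this]
  have hfc := hf.continuous
  refine MeasurableSet.iUnion fun b => MeasurableSet.iUnion fun _ => MeasurableSet.iUnion fun n =>
    (isClosed_iInter fun y => IsClosed.union ?_ ?_).measurableSet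
  · exact isClosed_le continuous_const (by fun_prop)
  · exact isClosed_le (by fun_prop) (by fun_prop)

end Lip
section LpFacts

variable {M : Type*} [MeasurableSpace M] {m : Measure M} {p : ℝ≥0∞}

instance fact_one_le [h : Fact (1 < p)] : Fact (1 ≤ p) := ⟨h.out.le⟩

instance fact_one_lt_two : Fact ((1 : ℝ≥0∞) < 2) := ⟨ENNReal.one_lt_two⟩

instance fact_two_lt_top : Fact ((2 : ℝ≥0∞) < ⊤) := ⟨ENNReal.ofNat_lt_top⟩

theorem one_lt_toReal [h1 : Fact (1 < p)] [h2 : Fact (p < ⊤)] : 1 < p.toReal := by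
  have := (ENNReal.toReal_lt_toReal ENNReal.one_ne_top h2.out.ne).2 h1.out
  simpa using this

theorem Lp_smul_nonneg {c : ℝ} (hc : 0 ≤ c) {a : Lp ℝ p m} (h : 0 ≤ a) : 0 ≤ c • a := by
  rw [← Lp.coeFn_nonneg] at h ⊢
  filter_upwards [h, Lp.coeFn_smul c a] with x hx h1
  rw [h1]
  exact mul_nonneg hc hx

theorem Lp_smul_le {c : ℝ} (hc : 0 ≤ c) {a b : Lp ℝ p m} (h : a ≤ b) : c • a ≤ c • b := by
  rw [← sub_nonneg, ← smul_sub]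
  exact Lp_smul_nonneg hc (sub_nonneg.2 h)

variable [h1 : Fact (1 < p)] [h2 : Fact (p < ⊤)]

theorem Lp_norm_rpow (a : Lp ℝ p m) :
    ‖a‖ ^ p.toReal = ∫ x, ‖a x‖ ^ p.toReal ∂m := by
  have hq := one_lt_toReal (p := p)
  have hp0 : p ≠ 0 := (zero_lt_one.trans h1.out).ne'
  have h0 : 0 ≤ ∫ x, ‖a x‖ ^ p.toReal ∂m := integral_nonneg fun x => by positivity
  rw [Lp.norm_def, (Lp.memLp a).eLpNorm_eq_integral_rpow_norm hp0 h2.out.ne,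
    ENNReal.toReal_ofReal (by positivity), Real.rpow_inv_rpow h0 (by linarith)]

theorem Lp_integrable (a : Lp ℝ p m) : Integrable (fun x => ‖a x‖ ^ p.toReal) m :=
  (Lp.memLp a).integrable_norm_rpow (zero_lt_one.trans h1.out).ne' h2.out.ne

theorem Lp_mono_rpow {a b : Lp ℝ p m} (ha : 0 ≤ a) (hab : a ≤ b) :
    ‖b - a‖ ^ p.toReal + ‖a‖ ^ p.toReal ≤ ‖b‖ ^ p.toReal := by
  have hq := one_lt_toReal (p := p)
  rw [Lp_norm_rpow, Lp_norm_rpow, Lp_norm_rpow, ← integral_add (Lp_integrable _) (Lp_integrable _)]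
  refine integral_mono_ae ((Lp_integrable _).add (Lp_integrable _)) (Lp_integrable _) ?_
  filter_upwards [(Lp.coeFn_nonneg a).2 ha, (Lp.coeFn_le a b).2 hab, Lp.coeFn_sub b a]
    with x hx1 hx2 hx3
  simp only [Pi.zero_apply] at hx1
  simp only [hx3, Pi.sub_apply, Real.norm_of_nonneg hx1,
    Real.norm_of_nonneg (hx1.trans hx2),
    Real.norm_of_nonneg (sub_nonneg.2 hx2)]
  simpa using Real.add_rpow_le_rpow_add (sub_nonneg.2 hx2) hx1 hq.le

theorem uc_pointwise {q : ℝ} (hq : 1 < q) {ε : ℝ} (hε : 0 < ε) :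
    ∃ C > 0, ∀ a b : ℝ, 0 ≤ a → 0 ≤ b →
      |a - b| ^ q ≤ ε * (a ^ q + b ^ q) + C * ((a ^ q + b ^ q) / 2 - ((a + b) / 2) ^ q) := by
  set h : ℝ → ℝ := fun t => (t ^ q + (1 - t) ^ q) / 2 - (1 / 2 : ℝ) ^ q with hh
  have hq0 : 0 ≤ q := by linarith
  have hc : Continuous h := by
    have := Real.continuous_rpow_const hq0
    have h2 : Continuous fun t : ℝ => (1 - t) ^ q := this.comp (by fun_prop)
    fun_prop
  have hc1 : Continuous fun t : ℝ => |t - (1 - t)| ^ q :=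
    (Real.continuous_rpow_const hq0).comp (by fun_prop)
  have hc2 : Continuous fun t : ℝ => ε * (t ^ q + (1 - t) ^ q) := by
    have := Real.continuous_rpow_const hq0
    have h2 : Continuous fun t : ℝ => (1 - t) ^ q := this.comp (by fun_prop)
    fun_prop
  set K : Set ℝ := Icc 0 1 ∩ {t | ε * (t ^ q + (1 - t) ^ q) ≤ |t - (1 - t)| ^ q} with hK
  have hKc : IsCompact K := isCompact_Icc.inter_right (isClosed_le hc2 hc1)
  have hnn : ∀ t ∈ Icc (0 : ℝ) 1, 0 ≤ h t := by
    intro t ht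
    have := (convexOn_rpow hq.le).2 (show t ∈ Ici (0 : ℝ) from ht.1)
      (show 1 - t ∈ Ici (0 : ℝ) by simpa using ht.2) (show (0 : ℝ) ≤ 1 / 2 by norm_num)
      (show (0 : ℝ) ≤ 1 / 2 by norm_num) (by norm_num)
    simp only [smul_eq_mul] at this
    have e : (1 / 2 * t + 1 / 2 * (1 - t) : ℝ) = 1 / 2 := by ring
    rw [e] at this
    simp only [hh]
    linarith
  have hpos : ∀ t ∈ K, 0 < h t := by
    rintro t ⟨ht, ht2⟩
    have hne : t ≠ 1 - t := by
      intro he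
      simp only [mem_ofPred_eq, ← he, sub_self, abs_zero] at ht2
      rw [Real.zero_rpow (by linarith)] at ht2
      have ht0 : 0 < t := by linarith
      have : 0 < t ^ q := Real.rpow_pos_of_pos ht0 q
      nlinarith
    have := (strictConvexOn_rpow hq).2 (show t ∈ Ici (0 : ℝ) from ht.1)
      (show 1 - t ∈ Ici (0 : ℝ) by simpa using ht.2) hne (show (0 : ℝ) < 1 / 2 by norm_num)
      (show (0 : ℝ) < 1 / 2 by norm_num) (by norm_num)
    simp only [smul_eq_mul] at this
    have e : (1 / 2 * t + 1 / 2 * (1 - t) : ℝ) = 1 / 2 := by ring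
    rw [e] at this
    simp only [hh]
    linarith
  obtain ⟨c, hc0, hcK⟩ : ∃ c > 0, ∀ t ∈ K, c ≤ h t := by
    rcases K.eq_empty_or_nonempty with he | hne
    · exact ⟨1, one_pos, by simp [he]⟩
    · obtain ⟨t0, ht0, hmin⟩ := hKc.exists_isMinOn hne hc.continuousOn
      exact ⟨h t0, hpos t0 ht0, fun t ht => hmin ht⟩
  refine ⟨1 / c, by positivity, ?_⟩
  have main : ∀ t ∈ Icc (0 : ℝ) 1,
      |t - (1 - t)| ^ q ≤ ε * (t ^ q + (1 - t) ^ q) + 1 / c * h t := by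
    intro t ht
    have hn1 : 0 ≤ t ^ q := Real.rpow_nonneg ht.1 q
    have hn2 : 0 ≤ (1 - t) ^ q := Real.rpow_nonneg (by linarith [ht.2]) q
    by_cases htK : t ∈ K
    · have h1 : |t - (1 - t)| ^ q ≤ 1 := by
        refine Real.rpow_le_one (abs_nonneg _) ?_ hq0
        rw [abs_le]; constructor <;> linarith [ht.1, ht.2]
      have h2 : 1 ≤ 1 / c * h t := by
        rw [one_div, inv_mul_eq_div, le_div_iff₀ hc0]; linarith [hcK t htK]
      nlinarith
    · have : |t - (1 - t)| ^ q < ε * (t ^ q + (1 - t) ^ q) := by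
        by_contra hcon
        exact htK ⟨ht, not_lt.1 hcon⟩
      have := hnn t ht
      have : 0 ≤ 1 / c * h t := by positivity
      linarith
  intro a b ha hb
  rcases (add_nonneg ha hb).eq_or_lt with h0 | h0
  · have ha0 : a = 0 := by linarith
    have hb0 : b = 0 := by linarith
    simp [ha0, hb0, Real.zero_rpow (by linarith : q ≠ 0)]
  · set s := a + b
    have hm := main (a / s) ⟨by positivity, by rw [div_le_one h0]; simp only [s]; linarith⟩
    have e1 : 1 - a / s = b / s := by field_simp; simp only [s]; ring
    simp only [hh] at hm
    rw [e1, ← sub_div, abs_div, abs_of_pos h0, Real.div_rpow (abs_nonneg _) h0.le,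
      Real.div_rpow ha h0.le, Real.div_rpow hb h0.le, Real.div_rpow zero_le_one (by norm_num)] at hm
    rw [Real.div_rpow h0.le (by norm_num)]
    have hs : 0 < s ^ q := Real.rpow_pos_of_pos h0 q
    have h2' : (0:ℝ) < 2 ^ q := Real.rpow_pos_of_pos (by norm_num) q
    have := mul_le_mul_of_nonneg_left hm hs.le
    rw [Real.one_rpow] at this
    field_simp at this ⊢
    linarith

theorem Lp_uc {ε : ℝ} (hε : 0 < ε) : ∃ C > 0, ∀ a b : Lp ℝ p m, 0 ≤ a → 0 ≤ b →
    ‖a - b‖ ^ p.toReal ≤ ε * (‖a‖ ^ p.toReal + ‖b‖ ^ p.toReal)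
      + C * ((‖a‖ ^ p.toReal + ‖b‖ ^ p.toReal) / 2 - ‖(1 / 2 : ℝ) • (a + b)‖ ^ p.toReal) := by
  obtain ⟨C, hC, hmain⟩ := uc_pointwise (one_lt_toReal (p := p)) hε
  refine ⟨C, hC, fun a b ha hb => ?_⟩
  simp only [Lp_norm_rpow]
  have hab : Integrable (fun x => ‖a x‖ ^ p.toReal + ‖b x‖ ^ p.toReal) m :=
    (Lp_integrable a).add (Lp_integrable b)
  have hI := Lp_integrable ((1 / 2 : ℝ) • (a + b))
  have hJ : Integrable (fun x => (‖a x‖ ^ p.toReal + ‖b x‖ ^ p.toReal) / 2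
      - ‖((1 / 2 : ℝ) • (a + b) : Lp ℝ p m) x‖ ^ p.toReal) m := (hab.div_const 2).sub hI
  have E : ∫ x, (ε * (‖a x‖ ^ p.toReal + ‖b x‖ ^ p.toReal)
      + C * ((‖a x‖ ^ p.toReal + ‖b x‖ ^ p.toReal) / 2
        - ‖((1 / 2 : ℝ) • (a + b) : Lp ℝ p m) x‖ ^ p.toReal)) ∂m
      = ε * (∫ x, ‖a x‖ ^ p.toReal ∂m + ∫ x, ‖b x‖ ^ p.toReal ∂m)
      + C * ((∫ x, ‖a x‖ ^ p.toReal ∂m + ∫ x, ‖b x‖ ^ p.toReal ∂m) / 2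
        - ∫ x, ‖((1 / 2 : ℝ) • (a + b) : Lp ℝ p m) x‖ ^ p.toReal ∂m) := by
    rw [integral_add (hab.const_mul ε) (hJ.const_mul C),
      integral_const_mul, integral_const_mul, integral_sub (hab.div_const 2) hI, integral_div,
      integral_add (Lp_integrable a) (Lp_integrable b)]
  rw [← E]
  refine integral_mono_ae (Lp_integrable _)
    ((hab.const_mul ε).add (hJ.const_mul C)) ?_
  filter_upwards [(Lp.coeFn_nonneg a).2 ha, (Lp.coeFn_nonneg b).2 hb, Lp.coeFn_sub a b,
    Lp.coeFn_smul (1 / 2 : ℝ) (a + b), Lp.coeFn_add a b] with x h1 h2 h3 h4 h5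
  simp only [Pi.zero_apply] at h1 h2
  have := hmain (a x) (b x) h1 h2
  simp only [h3, h4, h5, Pi.sub_apply, Pi.smul_apply, Pi.add_apply, smul_eq_mul]
  have e : (1 / 2 : ℝ) * (a x + b x) = (a x + b x) / 2 := by ring
  rw [e, Real.norm_of_nonneg h1, Real.norm_of_nonneg h2,
    Real.norm_of_nonneg (by linarith : 0 ≤ (a x + b x) / 2), Real.norm_eq_abs]
  exact this

/-- A nonempty set of non-negative elements of `Lp` has a greatest lower bound. -/
theorem exists_greatest_lowerBounds {S : Set (Lp ℝ p m)} (hne : S.Nonempty)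
    (h0 : ∀ G ∈ S, 0 ≤ G) : ∃ G, IsGreatest (lowerBounds S) G := by
  have hq := one_lt_toReal (p := p)
  have hq0 : 0 < p.toReal := by linarith
  obtain ⟨B, hB⟩ := hne
  set L : Set (Lp ℝ p m) := lowerBounds S ∩ Ici 0 with hL
  have hsup : ∀ a ∈ L, ∀ b ∈ lowerBounds S, a ⊔ b ∈ L := fun a ha b hb =>
    ⟨fun G hG => sup_le (ha.1 hG) (hb hG), (show 0 ≤ a from ha.2).trans le_sup_left⟩
  have hbd : ∀ a ∈ L, ‖a‖ ^ p.toReal ≤ ‖B‖ ^ p.toReal := fun a ha => by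
    have := Lp_mono_rpow ha.2 (ha.1 hB)
    have : 0 ≤ ‖B - a‖ ^ p.toReal := by positivity
    linarith
  have hLne : L.Nonempty := ⟨0, fun G hG => h0 G hG, le_refl (0 : Lp ℝ p m)⟩
  set N : Set ℝ := (fun a : Lp ℝ p m => ‖a‖ ^ p.toReal) '' L with hN
  have hNb : BddAbove N := ⟨‖B‖ ^ p.toReal, by rintro _ ⟨a, ha, rfl⟩; exact hbd a ha⟩
  have hNne : N.Nonempty := hLne.image _
  have hex : ∀ n : ℕ, ∃ a ∈ L, sSup N - 1 / ((n : ℝ) + 1) < ‖a‖ ^ p.toReal := by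
    intro n
    obtain ⟨_, ⟨a, ha, rfl⟩, h⟩ := exists_lt_of_lt_csSup hNne
      (show sSup N - 1 / ((n : ℝ) + 1) < sSup N by
        have : (0 : ℝ) < 1 / ((n : ℝ) + 1) := by positivity
        linarith)
    exact ⟨a, ha, h⟩
  choose a haL haN using hex
  -- the increasing sequence of maxima
  set b : ℕ → Lp ℝ p m := fun n => partialSups a n with hb
  have hbL : ∀ n, b n ∈ L := by
    intro n
    induction n with
    | zero => simpa [hb] using haL 0
    | succ n ih =>
      simp only [hb, partialSups_add_one] at ih ⊢
      exact hsup _ ih _ (haL _).1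
  have hmono : Monotone b := (partialSups a).monotone
  have hle : ∀ c ∈ L, ‖c‖ ^ p.toReal ≤ sSup N := fun c hc => le_csSup hNb ⟨c, hc, rfl⟩
  have hge : ∀ n : ℕ, sSup N - 1 / ((n : ℝ) + 1) ≤ ‖b n‖ ^ p.toReal := by
    intro n
    have h1 : a n ≤ b n := le_partialSups a n
    have := Lp_mono_rpow (haL n).2 h1
    have : 0 ≤ ‖b n - a n‖ ^ p.toReal := by positivity
    linarith [haN n]
  have hgap : ∀ n : ℕ, ∀ c ∈ L, b n ≤ c → ‖c - b n‖ ^ p.toReal ≤ 1 / ((n : ℝ) + 1) := by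
    intro n c hc hbc
    have := Lp_mono_rpow (hbL n).2 hbc
    linarith [hge n, hle c hc]
  have hcau : CauchySeq b := by
    rw [Metric.cauchySeq_iff']
    intro ε hε
    obtain ⟨n, hn⟩ := exists_nat_one_div_lt (Real.rpow_pos_of_pos hε p.toReal)
    refine ⟨n, fun k hk => ?_⟩
    rw [dist_eq_norm]
    exact (Real.rpow_lt_rpow_iff (norm_nonneg _) hε.le hq0).1
      ((hgap n _ (hbL k) (hmono hk)).trans_lt hn)
  obtain ⟨G, hG⟩ := cauchySeq_tendsto_of_complete hcau
  have hGL : G ∈ L :=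
    ⟨fun H hH => le_of_tendsto' hG fun n => (hbL n).1 hH, ge_of_tendsto' hG fun n => (hbL n).2⟩
  have hbG : ∀ n, b n ≤ G := fun n =>
    ge_of_tendsto hG (eventually_atTop.2 ⟨n, fun k hk => hmono hk⟩)
  refine ⟨G, hGL.1, fun H hH => ?_⟩
  have hm := hsup G hGL H hH
  have hz : ‖G ⊔ H - G‖ ^ p.toReal ≤ 0 := by
    have h1 := Lp_mono_rpow hGL.2 (le_sup_left : G ≤ G ⊔ H)
    have h3 : sSup N ≤ ‖G‖ ^ p.toReal := by
      have ht : Tendsto (fun n : ℕ => sSup N - 1 / ((n : ℝ) + 1)) atTop (𝓝 (sSup N - 0)) :=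
        tendsto_const_nhds.sub tendsto_one_div_add_atTop_nhds_zero_nat
      rw [sub_zero] at ht
      refine le_of_tendsto' ht fun n => (hge n).trans ?_
      have := Lp_mono_rpow (hbL n).2 (hbG n)
      have : 0 ≤ ‖G - b n‖ ^ p.toReal := by positivity
      linarith
    linarith [hle _ hm]
  have hz0 : ‖G ⊔ H - G‖ = 0 := by
    by_contra hcon
    have : 0 < ‖G ⊔ H - G‖ := lt_of_le_of_ne (norm_nonneg _) (Ne.symm hcon)
    exact absurd (Real.rpow_pos_of_pos this p.toReal) (not_lt.2 hz)
  rw [norm_eq_zero, sub_eq_zero] at hz0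
  rw [← hz0]
  exact le_sup_right

end LpFacts

/-! ### Convergence notions -/

section Convergence

/-- Convergence in `L⁰(m)`: convergence in measure on every set of finite measure. -/
def TendstoL0 {M : Type*} [MeasurableSpace M] (m : Measure M) (u : ℕ → M → ℝ) (f : M → ℝ) :
    Prop :=
  ∀ s : Set M, MeasurableSet s → m s < ⊤ → TendstoInMeasure (m.restrict s) u atTop f

/-- Weak convergence of a sequence in a normed space. -/
def TendstoWeakly {X : Type*} [NormedAddCommGroup X] [NormedSpace ℝ X] (u : ℕ → X) (x : X) :
    Prop :=
  ∀ φ : StrongDual ℝ X, Tendsto (fun n => φ (u n)) atTop (𝓝 (φ x))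

theorem TendstoWeakly.of_tendsto {X : Type*} [NormedAddCommGroup X] [NormedSpace ℝ X]
    {u : ℕ → X} {x : X} (h : Tendsto u atTop (𝓝 x)) : TendstoWeakly u x :=
  fun φ => (φ.continuous.tendsto x).comp h

theorem TendstoWeakly.bdd {X : Type*} [NormedAddCommGroup X] [NormedSpace ℝ X]
    {u : ℕ → X} {x : X} (h : TendstoWeakly u x) : ∃ B, ∀ n, ‖u n‖ ≤ B := by
  obtain ⟨B, hB⟩ := banach_steinhaus
    (g := fun n => NormedSpace.inclusionInDoubleDual ℝ X (u n)) (fun φ => by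
      obtain ⟨C, hC⟩ := (h φ).norm.bddAbove_range
      exact ⟨C, fun n => hC ⟨n, rfl⟩⟩)
  refine ⟨B, fun n => ?_⟩
  have := (NormedSpace.inclusionInDoubleDualLi ℝ (E := X)).norm_map (u n)
  exact this ▸ hB n

variable {M : Type*} [MeasurableSpace M] {m : Measure M}

theorem TendstoWeakly.nonneg {p : ℝ≥0∞} [Fact (1 ≤ p)] {u : ℕ → Lp ℝ p m} {a : Lp ℝ p m}
    (h : TendstoWeakly u a) (hu : ∀ n, 0 ≤ u n) : 0 ≤ a := by
  by_contra hcon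
  have hcone : Convex ℝ {a : Lp ℝ p m | 0 ≤ a} := by
    intro a ha b hb s t hs ht _
    exact add_nonneg (Lp_smul_nonneg hs ha) (Lp_smul_nonneg ht hb)
  obtain ⟨φ, s, hs1, hs2⟩ := geometric_hahn_banach_point_closed hcone
    (isClosed_le continuous_const continuous_id) hcon
  have := ge_of_tendsto' (h φ) fun n => (hs2 _ (hu n)).le
  linarith

theorem TendstoL0.exists_ae [SigmaFinite m] {u : ℕ → M → ℝ} {f : M → ℝ}
    (h : TendstoL0 m u f) :
    ∃ φ : ℕ → ℕ, StrictMono φ ∧ ∀ᵐ x ∂m, Tendsto (fun n => u (φ n) x) atTop (𝓝 (f x)) := by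
  set S := spanningSets m
  have hS : ∀ k, MeasurableSet (S k) := measurableSet_spanningSets m
  have hev : ∀ k : ℕ, ∀ᶠ n in atTop,
      m ({x | (2⁻¹ : ℝ≥0∞) ^ k ≤ edist (u n x) (f x)} ∩ S k) ≤ (2⁻¹ : ℝ≥0∞) ^ k := by
    intro k
    have hpos : (0 : ℝ≥0∞) < 2⁻¹ ^ k := ENNReal.pow_pos (by simp) k
    have := (h (S k) (hS k) (measure_spanningSets_lt_top m k)) _ hpos
    filter_upwards [this.eventually (ge_mem_nhds hpos)] with n hn
    rwa [Measure.restrict_apply' (hS k)] at hn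
  obtain ⟨φ, hφ, hφ2⟩ := extraction_forall_of_eventually hev
  refine ⟨φ, hφ, ?_⟩
  have hsum : ∑' k, m ({x | (2⁻¹ : ℝ≥0∞) ^ k ≤ edist (u (φ k) x) (f x)} ∩ S k) ≠ ⊤ := by
    refine ne_top_of_le_ne_top ?_ (ENNReal.tsum_le_tsum hφ2)
    simp [ENNReal.tsum_geometric, ENNReal.one_sub_inv_two]
  filter_upwards [ae_eventually_notMem hsum] with x hx
  have hxS : ∀ᶠ k in atTop, x ∈ S k := by
    have : x ∈ ⋃ k, S k := by rw [iUnion_spanningSets]; trivial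
    obtain ⟨k0, hk0⟩ := mem_iUnion.1 this
    exact eventually_atTop.2 ⟨k0, fun k hk => monotone_spanningSets m hk hk0⟩
  rw [tendsto_iff_edist_tendsto_0]
  refine tendsto_of_tendsto_of_tendsto_of_le_of_le' tendsto_const_nhds
    (ENNReal.tendsto_pow_atTop_nhds_zero_of_lt_one (r := 2⁻¹) (by simp)) (by simp) ?_
  filter_upwards [hx, hxS] with k hk hkS
  by_contra hcon
  exact hk ⟨(not_le.1 hcon).le, hkS⟩

theorem TendstoL0.of_ae {u : ℕ → M → ℝ} {f : M → ℝ} (hu : ∀ n, AEStronglyMeasurable (u n) m)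
    (h : ∀ᵐ x ∂m, Tendsto (fun n => u n x) atTop (𝓝 (f x))) : TendstoL0 m u f := by
  intro s hs hms
  have : IsFiniteMeasure (m.restrict s) := ⟨by simpa using hms⟩
  exact tendstoInMeasure_of_tendsto_ae (fun n => (hu n).restrict) (ae_restrict_of_ae h)

theorem TendstoL0.comp {u : ℕ → M → ℝ} {f : M → ℝ} (h : TendstoL0 m u f) {φ : ℕ → ℕ}
    (hφ : StrictMono φ) : TendstoL0 m (fun n => u (φ n)) f :=
  fun s hs hms ε hε => (h s hs hms ε hε).comp hφ.tendsto_atTop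

end Convergence

/-! ### Relaxation of the local Lipschitz constant -/

section Relaxation

variable {M : Type*} [MetricSpace M] [MeasurableSpace M] [BorelSpace M]

/-- The Lipschitz functions `f` with `lip f ∈ L^p(m)`. -/
def lipDomain (m : Measure M) (p : ℝ≥0∞) : Submodule ℝ (M → ℝ) where
  carrier := {f | IsLip f ∧ MemLp (lip f) p m}
  add_mem' := by
    rintro f g ⟨hf, hf'⟩ ⟨hg, hg'⟩
    refine ⟨hf.add hg, (hf'.add hg').mono (hf.add hg).measurable_lip.aestronglyMeasurable
      (Eventually.of_forall fun x => ?_)⟩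
    rw [Real.norm_of_nonneg ((hf.add hg).lip_nonneg x), Pi.add_apply,
      Real.norm_of_nonneg (add_nonneg (hf.lip_nonneg x) (hg.lip_nonneg x))]
    exact lip_add_le hf hg x
  zero_mem' := by
    have h0 : IsLip (0 : M → ℝ) := ⟨0, LipschitzWith.const 0⟩
    have : lip (0 : M → ℝ) = 0 := by
      ext x
      simpa using lip_smul h0 0 x
    exact ⟨h0, by rw [this]; exact MemLp.zero⟩
  smul_mem' := by
    rintro c f ⟨hf, hf'⟩
    refine ⟨hf.smul c, ?_⟩
    have : lip (c • f) = |c| • lip f := by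
      ext x
      simpa using lip_smul hf c x
    exact this ▸ hf'.const_smul _

variable {m : Measure M} {p : ℝ≥0∞}

/-- The functional `f ↦ lip f`, with values in `L^p(m)`. -/
def slopeLp (f : lipDomain m p) : Lp ℝ p m := MemLp.toLp (lip (f : M → ℝ)) f.2.2

theorem slopeLp_coe (f : lipDomain m p) : slopeLp f =ᵐ[m] lip (f : M → ℝ) :=
  MemLp.coeFn_toLp _

theorem slopeLp_nonneg (f : lipDomain m p) : 0 ≤ slopeLp f := by
  rw [← Lp.coeFn_nonneg]
  filter_upwards [slopeLp_coe f] with x hx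
  rw [hx]
  exact f.2.1.lip_nonneg x

theorem slopeLp_add_le (f g : lipDomain m p) : slopeLp (f + g) ≤ slopeLp f + slopeLp g := by
  rw [← Lp.coeFn_le]
  filter_upwards [slopeLp_coe f, slopeLp_coe g, slopeLp_coe (f + g),
    Lp.coeFn_add (slopeLp f) (slopeLp g)] with x h1 h2 h3 h4
  rw [h3, h4, Pi.add_apply, h1, h2]
  exact lip_add_le f.2.1 g.2.1 x

theorem slopeLp_smul (c : ℝ) (f : lipDomain m p) : slopeLp (c • f) = |c| • slopeLp f := by
  apply Lp.ext
  filter_upwards [slopeLp_coe f, slopeLp_coe (c • f), Lp.coeFn_smul |c| (slopeLp f)]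
    with x h1 h2 h3
  rw [h2, h3, Pi.smul_apply, h1]
  exact lip_smul f.2.1 c x

theorem lipDomain_aesm (f : lipDomain m p) : AEStronglyMeasurable (f : M → ℝ) m :=
  f.2.1.continuous.aestronglyMeasurable

variable [h1 : Fact (1 < p)]

variable (m p) in
/-- The weak `L^p`-limits of `lip fₙ`, over all sequences `fₙ → f` in `L⁰(m)` of Lipschitz
functions with `lip fₙ ∈ L^p(m)`. -/
def weakSlopeLimits (f : M → ℝ) : Set (Lp ℝ p m) :=
  {G | ∃ u : ℕ → lipDomain m p, TendstoL0 m (fun n => (u n : M → ℝ)) f ∧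
    TendstoWeakly (fun n => slopeLp (u n)) G}

theorem weakSlopeLimits_nonneg {f : M → ℝ} : ∀ G ∈ weakSlopeLimits m p f, 0 ≤ G := by
  rintro G ⟨u, -, hu⟩
  exact hu.nonneg fun n => slopeLp_nonneg _

variable (m p) in
/-- The lower semicontinuous hull in `L⁰(m)` of `f ↦ ∫ (lip f)^p dm`. -/
def lscHull (f : M → ℝ) : ℝ≥0∞ :=
  ⨅ (u : ℕ → lipDomain m p) (_ : TendstoL0 m (fun n => (u n : M → ℝ)) f),
    liminf (fun n => ∫⁻ x, ENNReal.ofReal (lip (u n : M → ℝ) x) ^ p.toReal ∂m) atTop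

variable [h2 : Fact (p < ⊤)]

theorem slopeLp_norm_rpow (u : lipDomain m p) :
    ENNReal.ofReal (‖slopeLp u‖) ^ p.toReal
      = ∫⁻ x, ENNReal.ofReal (lip (u : M → ℝ) x) ^ p.toReal ∂m := by
  have hq := one_lt_toReal (p := p)
  have hp0 : p ≠ 0 := (zero_lt_one.trans h1.out).ne'
  rw [slopeLp, Lp.norm_toLp, ENNReal.ofReal_toReal u.2.2.2.ne,
    eLpNorm_eq_lintegral_rpow_enorm_toReal hp0 h2.out.ne, ← ENNReal.rpow_mul,
    one_div_mul_cancel (by linarith), ENNReal.rpow_one]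
  refine lintegral_congr fun x => ?_
  rw [Real.enorm_eq_ofReal (u.2.1.lip_nonneg x)]

theorem lscHull_lt_top_iff (f : M → ℝ) : lscHull m p f < ⊤ ↔
    ∃ u : ℕ → lipDomain m p, TendstoL0 m (fun n => (u n : M → ℝ)) f ∧
      ∃ B : ℝ, ∀ n, ‖slopeLp (u n)‖ ≤ B := by
  have hq := one_lt_toReal (p := p)
  have hq0 : 0 < p.toReal := by linarith
  simp only [lscHull, iInf_lt_iff, ← slopeLp_norm_rpow]
  constructor
  · rintro ⟨u, hu, hlt⟩
    obtain ⟨c, hc, hc2⟩ := exists_between hlt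
    have hfreq := frequently_lt_of_liminf_lt (by isBoundedDefault) hc
    obtain ⟨φ, hφ, hφ2⟩ := extraction_of_frequently_atTop hfreq
    refine ⟨fun n => u (φ n), hu.comp hφ, (c ^ p.toReal⁻¹).toReal, fun n => ?_⟩
    have h3 := (ENNReal.rpow_le_rpow_iff (inv_pos.2 hq0)).2 (hφ2 n).le
    rw [← ENNReal.rpow_mul, mul_inv_cancel₀ hq0.ne', ENNReal.rpow_one] at h3
    refine (ENNReal.ofReal_le_iff_le_toReal ?_).1 h3
    exact ENNReal.rpow_ne_top_of_nonneg (by positivity) hc2.ne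
  · rintro ⟨u, hu, B, hB⟩
    refine ⟨u, hu, lt_of_le_of_lt (b := ENNReal.ofReal B ^ p.toReal) ?_
      (ENNReal.rpow_lt_top_of_nonneg hq0.le ENNReal.ofReal_ne_top)⟩
    refine liminf_le_of_le (by isBoundedDefault) fun b hb => ?_
    obtain ⟨n, hn⟩ := hb.exists
    exact hn.trans (ENNReal.rpow_le_rpow (ENNReal.ofReal_le_ofReal (hB n)) hq0.le)

/-- Convex combinations of the tails of a sequence with bounded slopes can be chosen such that
their slopes converge strongly in `L^p`. -/
theorem exists_weakSlopeLimit {f : M → ℝ} (u : ℕ → lipDomain m p) (w : ℕ → Lp ℝ p m)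
    (hu : ∀ᵐ x ∂m, Tendsto (fun n => (u n : M → ℝ) x) atTop (𝓝 (f x)))
    (huw : ∀ n, slopeLp (u n) ≤ w n) {B : ℝ} (hB : ∀ n, ‖w n‖ ≤ B) :
    ∃ G ∈ weakSlopeLimits m p f, ∀ H, TendstoWeakly w H → G ≤ H := by
  have hq := one_lt_toReal (p := p)
  have hq0 : 0 < p.toReal := by linarith
  set C : ℕ → Set (lipDomain m p × Lp ℝ p m) := fun n =>
    convexHull ℝ ((fun k => (u k, w k)) '' Ici n) with hC
  have hCconv : ∀ n, Convex ℝ (C n) := fun n => convex_convexHull ℝ _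
  have hCmono : ∀ {n k}, n ≤ k → C k ⊆ C n := fun hnk =>
    convexHull_mono (image_mono (Ici_subset_Ici.2 hnk))
  have hCmem : ∀ n, (u n, w n) ∈ C n := fun n => subset_convexHull ℝ _ ⟨n, self_mem_Ici, rfl⟩
  have hCsub : ∀ {n : ℕ} {T : Set (lipDomain m p × Lp ℝ p m)}, Convex ℝ T →
      (∀ k, n ≤ k → (u k, w k) ∈ T) → C n ⊆ T := by
    intro n T hT h
    refine convexHull_min ?_ hT
    rintro _ ⟨k, hk, rfl⟩
    exact h k hk
  have hslope : ∀ n, ∀ v ∈ C n, slopeLp v.1 ≤ v.2 := by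
    intro n
    refine hCsub (T := {v | slopeLp v.1 ≤ v.2}) ?_ fun k _ => huw k
    intro v hv v' hv' a b ha hb _
    calc slopeLp (a • v.1 + b • v'.1) ≤ slopeLp (a • v.1) + slopeLp (b • v'.1) :=
          slopeLp_add_le _ _
      _ = a • slopeLp v.1 + b • slopeLp v'.1 := by
          rw [slopeLp_smul, slopeLp_smul, abs_of_nonneg ha, abs_of_nonneg hb]
      _ ≤ a • v.2 + b • v'.2 := add_le_add (Lp_smul_le ha hv) (Lp_smul_le hb hv')
  have hbdd : ∀ n, ∀ v ∈ C n, ‖slopeLp v.1‖ ≤ B := by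
    intro n v hv
    have h1 : ‖v.2‖ ≤ B := by
      have hcv : Convex ℝ {v : lipDomain m p × Lp ℝ p m | ‖v.2‖ ≤ B} := by
        have := (convex_closedBall (0 : Lp ℝ p m) B).linear_preimage
          (LinearMap.snd ℝ (lipDomain m p) (Lp ℝ p m))
        simpa [preimage, Metric.mem_closedBall, dist_zero_right] using this
      exact hCsub hcv (fun k _ => hB k) hv
    refine le_trans (norm_le_norm_of_abs_le_abs ?_) h1
    have h0 := slopeLp_nonneg v.1
    rw [abs_of_nonneg h0, abs_of_nonneg (h0.trans (hslope n v hv))]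
    exact hslope n v hv
  -- minimal energies of the tails
  set N : ℕ → Set ℝ := fun n => (fun v => ‖slopeLp v.1‖ ^ p.toReal) '' C n with hN
  have hNne : ∀ n, (N n).Nonempty := fun n => ⟨_, _, hCmem n, rfl⟩
  have hNb : ∀ n, BddBelow (N n) := fun n => ⟨0, by rintro _ ⟨v, _, rfl⟩; positivity⟩
  set I : ℕ → ℝ := fun n => sInf (N n) with hI
  have hImono : Monotone I := fun n k hnk =>
    csInf_le_csInf (hNb n) (hNne k) (image_mono (hCmono hnk))
  have hIle : ∀ n, ∀ v ∈ C n, I n ≤ ‖slopeLp v.1‖ ^ p.toReal := fun n v hv =>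
    csInf_le (hNb n) ⟨v, hv, rfl⟩
  have hIb : BddAbove (range I) := by
    refine ⟨B ^ p.toReal, ?_⟩
    rintro _ ⟨n, rfl⟩
    exact (hIle n _ (hCmem n)).trans
      (Real.rpow_le_rpow (norm_nonneg _) (hbdd n _ (hCmem n)) hq0.le)
  have hIlim := tendsto_atTop_ciSup hImono hIb
  set J := ⨆ n, I n
  have hex : ∀ n : ℕ, ∃ v ∈ C n, ‖slopeLp v.1‖ ^ p.toReal < I n + 1 / ((n : ℝ) + 1) := by
    intro n
    obtain ⟨_, ⟨v, hv, rfl⟩, h⟩ := exists_lt_of_csInf_lt (hNne n)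
      (show sInf (N n) < I n + 1 / ((n : ℝ) + 1) by
        have : (0 : ℝ) < 1 / ((n : ℝ) + 1) := by positivity
        linarith)
    exact ⟨v, hv, h⟩
  choose v hvC hvI using hex
  have hhalf : ∀ n k, n ≤ k →
      I n ≤ ‖(1 / 2 : ℝ) • (slopeLp (v n).1 + slopeLp (v k).1)‖ ^ p.toReal := by
    intro n k hnk
    have hmid : (1 / 2 : ℝ) • v n + (1 / 2 : ℝ) • v k ∈ C n :=
      hCconv n (hvC n) (hCmono hnk (hvC k)) (by norm_num) (by norm_num) (by norm_num)
    refine (hIle n _ hmid).trans (Real.rpow_le_rpow (norm_nonneg _) ?_ hq0.le)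
    have hle : slopeLp ((1 / 2 : ℝ) • v n + (1 / 2 : ℝ) • v k).1
        ≤ (1 / 2 : ℝ) • (slopeLp (v n).1 + slopeLp (v k).1) := by
      refine (slopeLp_add_le _ _).trans (le_of_eq ?_)
      rw [Prod.smul_fst, Prod.smul_fst, slopeLp_smul, slopeLp_smul,
        abs_of_nonneg (by norm_num : (0 : ℝ) ≤ 1 / 2), smul_add]
    refine norm_le_norm_of_abs_le_abs ?_
    have h0 := slopeLp_nonneg ((1 / 2 : ℝ) • v n + (1 / 2 : ℝ) • v k).1
    rwa [abs_of_nonneg h0, abs_of_nonneg (h0.trans hle)]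
  have hcau : CauchySeq fun n => slopeLp (v n).1 := by
    rw [Metric.cauchySeq_iff']
    intro ε hε
    have hεq := Real.rpow_pos_of_pos hε p.toReal
    set R := B ^ p.toReal
    have hR : ∀ n, ‖slopeLp (v n).1‖ ^ p.toReal ≤ R := fun n =>
      Real.rpow_le_rpow (norm_nonneg _) (hbdd n _ (hvC n)) hq0.le
    have hR0 : 0 ≤ R := le_trans (by positivity) (hR 0)
    obtain ⟨K, hK, hKuc⟩ := Lp_uc (m := m) (p := p)
      (ε := ε ^ p.toReal / (4 * (R + 1))) (by positivity)
    -- the defect tends to zero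
    have hdef : Tendsto (fun n : ℕ => K * (J - I n + 1 / ((n : ℝ) + 1))) atTop
        (𝓝 (K * (J - J + 0))) :=
      ((tendsto_const_nhds.sub hIlim).add tendsto_one_div_add_atTop_nhds_zero_nat).const_mul K
    rw [sub_self, add_zero, mul_zero] at hdef
    obtain ⟨n, hn⟩ := (hdef.eventually (gt_mem_nhds (half_pos hεq))).exists
    refine ⟨n, fun k hk => ?_⟩
    rw [dist_eq_norm, norm_sub_rev]
    refine (Real.rpow_lt_rpow_iff (norm_nonneg _) hε.le hq0).1 ?_
    have h1 := hKuc (slopeLp (v n).1) (slopeLp (v k).1) (slopeLp_nonneg _) (slopeLp_nonneg _)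
    have h2 : ε ^ p.toReal / (4 * (R + 1)) *
        (‖slopeLp (v n).1‖ ^ p.toReal + ‖slopeLp (v k).1‖ ^ p.toReal) ≤ ε ^ p.toReal / 2 := by
      calc _ ≤ ε ^ p.toReal / (4 * (R + 1)) * (2 * (R + 1)) := by
            gcongr
            linarith [hR n, hR k]
        _ = ε ^ p.toReal / 2 := by field_simp; norm_num
    have h3 : (‖slopeLp (v n).1‖ ^ p.toReal + ‖slopeLp (v k).1‖ ^ p.toReal) / 2
        - ‖(1 / 2 : ℝ) • (slopeLp (v n).1 + slopeLp (v k).1)‖ ^ p.toReal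
        ≤ J - I n + 1 / ((n : ℝ) + 1) := by
      have e1 := hhalf n k hk
      have e2 := hvI n
      have e3 := hvI k
      have e4 : I k ≤ J := le_ciSup hIb k
      have e5 : I n ≤ J := le_ciSup hIb n
      have e6 : 1 / ((k : ℝ) + 1) ≤ 1 / ((n : ℝ) + 1) := by gcongr
      linarith
    have h4 := mul_le_mul_of_nonneg_left h3 hK.le
    linarith
  obtain ⟨G, hG⟩ := cauchySeq_tendsto_of_complete hcau
  refine ⟨G, ⟨fun n => (v n).1, ?_, TendstoWeakly.of_tendsto hG⟩, fun H hH => ?_⟩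
  · refine TendstoL0.of_ae (fun n => lipDomain_aesm _) ?_
    filter_upwards [hu] with x hx
    rw [Metric.tendsto_atTop] at hx ⊢
    intro ε hε
    obtain ⟨n, hn⟩ := hx ε hε
    refine ⟨n, fun k hk => ?_⟩
    have hcv : Convex ℝ {v : lipDomain m p × Lp ℝ p m | (v.1 : M → ℝ) x ∈ Metric.ball (f x) ε} :=
      (convex_ball (f x) ε).linear_preimage ((LinearMap.proj x).comp
        ((lipDomain m p).subtype.comp (LinearMap.fst ℝ (lipDomain m p) (Lp ℝ p m))))
    exact hCsub hcv (fun j hj => hn j hj) (hCmono hk (hvC k))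
  · -- the second components converge weakly to `H`
    have hw : TendstoWeakly (fun n => (v n).2) H := by
      intro φ
      have hx := hH φ
      rw [Metric.tendsto_atTop] at hx ⊢
      intro ε hε
      obtain ⟨n, hn⟩ := hx ε hε
      refine ⟨n, fun k hk => ?_⟩
      have hcv : Convex ℝ {v : lipDomain m p × Lp ℝ p m | φ v.2 ∈ Metric.ball (φ H) ε} :=
        (convex_ball (φ H) ε).linear_preimage ((φ : Lp ℝ p m →ₗ[ℝ] ℝ).comp
          (LinearMap.snd ℝ (lipDomain m p) (Lp ℝ p m)))
      exact hCsub hcv (fun j hj => hn j hj) (hCmono hk (hvC k))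
    rw [← sub_nonneg]
    refine TendstoWeakly.nonneg (u := fun n => (v n).2 - slopeLp (v n).1) (fun φ => ?_)
      fun n => sub_nonneg.2 (hslope n _ (hvC n))
    simp only [map_sub]
    exact (hw φ).sub (TendstoWeakly.of_tendsto hG φ)

variable [SigmaFinite m]

theorem weakSlopeLimits_nonempty {f : M → ℝ} (hf : lscHull m p f < ⊤) :
    (weakSlopeLimits m p f).Nonempty := by
  obtain ⟨u, hu, B, hB⟩ := (lscHull_lt_top_iff f).1 hf
  obtain ⟨φ, hφ, hφ2⟩ := hu.exists_ae
  obtain ⟨G, hG, -⟩ := exists_weakSlopeLimit (fun n => u (φ n)) (fun n => slopeLp (u (φ n))) hφ2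
    (fun n => le_rfl) (fun n => hB (φ n))
  exact ⟨G, hG⟩

end Relaxation

/-! ### The relaxed slope -/

section RelaxedSlope

variable {M : Type*} [MetricSpace M] [MeasurableSpace M] [BorelSpace M]

variable {m : Measure M} {p : ℝ≥0∞} [h1 : Fact (1 < p)]

theorem norm_slopeLp_smul (c : ℝ) (u : lipDomain m p) :
    ‖slopeLp (c • u)‖ = |c| * ‖slopeLp u‖ := by
  rw [slopeLp_smul, norm_smul, Real.norm_eq_abs, abs_abs]

theorem norm_slopeLp_add_le (u v : lipDomain m p) :
    ‖slopeLp (u + v)‖ ≤ ‖slopeLp u‖ + ‖slopeLp v‖ := by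
  refine le_trans (norm_le_norm_of_abs_le_abs ?_) (norm_add_le _ _)
  have h := slopeLp_add_le u v
  have h0 := slopeLp_nonneg (u + v)
  rwa [abs_of_nonneg h0, abs_of_nonneg (h0.trans h)]

variable [h2 : Fact (p < ⊤)]

theorem lscHull_lt_top_of_ae {f : M → ℝ} (u : ℕ → lipDomain m p)
    (hu : ∀ᵐ x ∂m, Tendsto (fun n => (u n : M → ℝ) x) atTop (𝓝 (f x))) {B : ℝ}
    (hB : ∀ n, ‖slopeLp (u n)‖ ≤ B) : lscHull m p f < ⊤ :=
  (lscHull_lt_top_iff f).2 ⟨u, TendstoL0.of_ae (fun _ => lipDomain_aesm _) hu, B, hB⟩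

variable [SigmaFinite m]

theorem exists_ae_of_lscHull {f : M → ℝ} (hf : lscHull m p f < ⊤) :
    ∃ u : ℕ → lipDomain m p,
      (∀ᵐ x ∂m, Tendsto (fun n => (u n : M → ℝ) x) atTop (𝓝 (f x))) ∧
      ∃ B, ∀ n, ‖slopeLp (u n)‖ ≤ B := by
  obtain ⟨u, hu, B, hB⟩ := (lscHull_lt_top_iff f).1 hf
  obtain ⟨φ, -, hφ⟩ := hu.exists_ae
  exact ⟨fun n => u (φ n), hφ, B, fun n => hB _⟩

variable (m p) in
/-- The domain of the relaxed functional: the classes `f ∈ L⁰(m)` at which the lower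
semicontinuous hull of `f ↦ ∫ (lip f)^p dm` is finite. -/
def relaxedDomain : Submodule ℝ (M →ₘ[m] ℝ) where
  carrier := {f | lscHull m p f < ⊤}
  add_mem' := by
    intro f g hf hg
    obtain ⟨u, hu, B, hB⟩ := exists_ae_of_lscHull hf
    obtain ⟨v, hv, B', hB'⟩ := exists_ae_of_lscHull hg
    refine lscHull_lt_top_of_ae (fun n => u n + v n) ?_ (B := B + B')
      fun n => (norm_slopeLp_add_le _ _).trans (add_le_add (hB n) (hB' n))
    filter_upwards [hu, hv, AEEqFun.coeFn_add f g] with x h1 h2 h3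
    rw [h3]
    exact h1.add h2
  zero_mem' := by
    refine lscHull_lt_top_of_ae (fun _ => 0) ?_ (fun n => le_rfl)
    filter_upwards [AEEqFun.coeFn_zero (α := M) (μ := m) (β := ℝ)] with x hx
    rw [hx]
    exact tendsto_const_nhds
  smul_mem' := by
    intro c f hf
    obtain ⟨u, hu, B, hB⟩ := exists_ae_of_lscHull hf
    refine lscHull_lt_top_of_ae (fun n => c • u n) ?_ (B := |c| * B) fun n => ?_
    · filter_upwards [hu, AEEqFun.coeFn_smul c f] with x h1 h3
      rw [h3]
      exact h1.const_smul c
    · rw [norm_slopeLp_smul]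
      gcongr
      exact hB n

theorem exists_relaxedSlope (f : relaxedDomain m p) :
    ∃ G, IsGreatest (lowerBounds (weakSlopeLimits m p f)) G :=
  exists_greatest_lowerBounds (weakSlopeLimits_nonempty f.2) weakSlopeLimits_nonneg

/-- The relaxed slope `|Df|_{*,p}`: the greatest `G ∈ L^p(m)` such that `G ≤ G'` a.e. for every
weak `L^p`-limit `G'` of `lip fₙ` along a sequence `fₙ → f` in `L⁰(m)`. -/
def relaxedSlope (f : relaxedDomain m p) : Lp ℝ p m :=
  (exists_relaxedSlope f).choose

theorem isGreatest_relaxedSlope (f : relaxedDomain m p) :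
    IsGreatest (lowerBounds (weakSlopeLimits m p f)) (relaxedSlope f) :=
  (exists_relaxedSlope f).choose_spec

theorem relaxedSlope_nonneg (f : relaxedDomain m p) : 0 ≤ relaxedSlope f :=
  (isGreatest_relaxedSlope f).2 weakSlopeLimits_nonneg

theorem relaxedSlope_add_le (f g : relaxedDomain m p) :
    relaxedSlope (f + g) ≤ relaxedSlope f + relaxedSlope g := by
  have key : ∀ G ∈ weakSlopeLimits m p f, ∀ G' ∈ weakSlopeLimits m p g,
      relaxedSlope (f + g) ≤ G + G' := by
    rintro G ⟨u, hu, huG⟩ G' ⟨v, hv, hvG⟩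
    obtain ⟨φ, hφ, hφu⟩ := hu.exists_ae
    obtain ⟨ψ, hψ, hψv⟩ := (hv.comp hφ).exists_ae
    have hu' : TendstoWeakly (fun n => slopeLp (u (φ (ψ n)))) G :=
      fun χ => (huG χ).comp (hφ.comp hψ).tendsto_atTop
    have hv' : TendstoWeakly (fun n => slopeLp (v (φ (ψ n)))) G' :=
      fun χ => (hvG χ).comp (hφ.comp hψ).tendsto_atTop
    have hw : TendstoWeakly
        (fun n => slopeLp (u (φ (ψ n))) + slopeLp (v (φ (ψ n)))) (G + G') := by
      intro χ
      simp only [map_add]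
      exact (hu' χ).add (hv' χ)
    obtain ⟨B, hB⟩ := hw.bdd
    obtain ⟨H, hH, hH'⟩ := exists_weakSlopeLimit (f := ((f + g : relaxedDomain m p) : M →ₘ[m] ℝ))
      (fun n => u (φ (ψ n)) + v (φ (ψ n))) _ (by
        filter_upwards [hφu, hψv, AEEqFun.coeFn_add (f : M →ₘ[m] ℝ) (g : M →ₘ[m] ℝ)]
          with x h1 h2 h3
        rw [Submodule.coe_add, h3]
        exact (h1.comp hψ.tendsto_atTop).add h2) (fun n => slopeLp_add_le _ _) hB
    exact ((isGreatest_relaxedSlope (f + g)).1 hH).trans (hH' _ hw)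
  rw [← sub_le_iff_le_add]
  refine (isGreatest_relaxedSlope f).2 fun G hG => ?_
  rw [sub_le_iff_le_add, ← sub_le_iff_le_add']
  refine (isGreatest_relaxedSlope g).2 fun G' hG' => ?_
  rw [sub_le_iff_le_add']
  exact key G hG G' hG'

theorem relaxedSlope_smul_le (c : ℝ) (f : relaxedDomain m p) :
    relaxedSlope (c • f) ≤ |c| • relaxedSlope f := by
  have key : ∀ G ∈ weakSlopeLimits m p f, relaxedSlope (c • f) ≤ |c| • G := by
    rintro G ⟨u, hu, huG⟩
    obtain ⟨φ, hφ, hφu⟩ := hu.exists_ae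
    refine (isGreatest_relaxedSlope (c • f)).1 ⟨fun n => c • u (φ n),
      TendstoL0.of_ae (fun n => lipDomain_aesm _) ?_, fun χ => ?_⟩
    · filter_upwards [hφu, AEEqFun.coeFn_smul c (f : M →ₘ[m] ℝ)] with x h1 h3
      rw [Submodule.coe_smul, h3]
      exact h1.const_smul c
    · simp only [slopeLp_smul, map_smul]
      exact ((huG χ).comp hφ.tendsto_atTop).const_smul |c|
  rcases eq_or_ne c 0 with rfl | hc
  · obtain ⟨G, hG⟩ := weakSlopeLimits_nonempty f.2
    simpa using key G hG
  · have hc' : 0 < |c| := abs_pos.2 hc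
    have h : |c|⁻¹ • relaxedSlope (c • f) ≤ relaxedSlope f :=
      (isGreatest_relaxedSlope f).2 fun G hG => by
        have := Lp_smul_le (inv_nonneg.2 hc'.le) (key G hG)
        rwa [smul_smul, inv_mul_cancel₀ hc'.ne', one_smul] at this
    have := Lp_smul_le hc'.le h
    rwa [smul_smul, mul_inv_cancel₀ hc'.ne', one_smul] at this

theorem relaxedSlope_smul (c : ℝ) (f : relaxedDomain m p) :
    relaxedSlope (c • f) = |c| • relaxedSlope f := by
  refine le_antisymm (relaxedSlope_smul_le c f) ?_
  rcases eq_or_ne c 0 with rfl | hc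
  · simpa using relaxedSlope_nonneg ((0 : ℝ) • f)
  · have hc' : 0 < |c| := abs_pos.2 hc
    have h := Lp_smul_le hc'.le (relaxedSlope_smul_le c⁻¹ (c • f))
    rwa [smul_smul, smul_smul, inv_mul_cancel₀ hc, one_smul, abs_inv, mul_inv_cancel₀ hc'.ne',
      one_smul] at h

end RelaxedSlope

/-! ### The module generated by a sublinear `L^p`-valued functional -/

section Module

variable {M : Type*} [MeasurableSpace M]

/-- A subadditive and absolutely homogeneous functional `f ↦ g_f`, defined on a linear subspace
of `L⁰(m)` and with values in the non-negative elements of `L^p(m)`. -/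
structure SublinearFunctional (m : Measure M) (p : ℝ≥0∞) where
  /-- the domain of definition -/
  domain : Submodule ℝ (M →ₘ[m] ℝ)
  /-- the value `g_f` -/
  val : domain → Lp ℝ p m
  val_nonneg : ∀ f, 0 ≤ val f
  val_add_le : ∀ f h, val (f + h) ≤ val f + val h
  val_smul : ∀ (c : ℝ) (f), val (c • f) = |c| • val f

namespace SublinearFunctional

variable {m : Measure M} {p : ℝ≥0∞} (F : SublinearFunctional m p)

/-- The pointwise norm `x ↦ g_{s x} x` of a family `s` of elements of the domain; if `s = f i`
on `A i` for a partition `(A i)`, it equals `g_{f i}` on `A i`. -/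
def pointwiseNorm (s : M → F.domain) (x : M) : ℝ := F.val (s x) x

/-- A family with countably many values, all of whose level sets are measurable. It is the same
thing as a sequence `(f i, A i)` with `f i` in the domain and `(A i)` a countable measurable
partition, up to the labelling of the pieces. -/
def IsSimple (s : M → F.domain) : Prop :=
  (range s).Countable ∧ ∀ f, MeasurableSet (s ⁻¹' {f})

variable {F}

theorem IsSimple.measurable_comp {β : Type*} [MeasurableSpace β] {s : M → F.domain}
    (hs : F.IsSimple s) {φ : F.domain → M → β} (hφ : ∀ f, Measurable (φ f)) :
    Measurable fun x => φ (s x) x := by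
  intro B hB
  have : (fun x => φ (s x) x) ⁻¹' B = ⋃ f ∈ range s, s ⁻¹' {f} ∩ φ f ⁻¹' B := by
    ext x
    simp only [mem_preimage, mem_iUnion, mem_inter_iff, mem_singleton_iff, exists_prop]
    exact ⟨fun h => ⟨s x, ⟨x, rfl⟩, rfl, h⟩, by rintro ⟨f, -, rfl, h⟩; exact h⟩
  rw [this]
  exact MeasurableSet.biUnion hs.1 fun f _ => (hs.2 f).inter (hφ f hB)

theorem IsSimple.aesm {s : M → F.domain} (hs : F.IsSimple s) :
    AEStronglyMeasurable (F.pointwiseNorm s) m :=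
  (hs.measurable_comp (φ := fun f x => F.val f x)
    fun f => (Lp.stronglyMeasurable (F.val f)).measurable).aestronglyMeasurable

theorem IsSimple.add {s t : M → F.domain} (hs : F.IsSimple s) (ht : F.IsSimple t) :
    F.IsSimple (s + t) := by
  refine ⟨((hs.1.prod ht.1).image fun q => q.1 + q.2).mono ?_, fun f => ?_⟩
  · rintro _ ⟨x, rfl⟩
    exact ⟨(s x, t x), ⟨⟨x, rfl⟩, ⟨x, rfl⟩⟩, rfl⟩
  · have : (s + t) ⁻¹' {f} = ⋃ a ∈ range s, s ⁻¹' {a} ∩ t ⁻¹' {f - a} := by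
      ext x
      simp only [mem_preimage, mem_iUnion, mem_inter_iff, mem_singleton_iff, exists_prop,
        Pi.add_apply]
      constructor
      · rintro rfl
        exact ⟨s x, ⟨x, rfl⟩, rfl, by simp⟩
      · rintro ⟨a, -, rfl, h⟩
        simp [h]
    rw [this]
    exact MeasurableSet.biUnion hs.1 fun a _ => (hs.2 a).inter (ht.2 _)

theorem IsSimple.comp {s : M → F.domain} (hs : F.IsSimple s) (φ : F.domain → F.domain) :
    F.IsSimple (fun x => φ (s x)) := by
  refine ⟨(hs.1.image φ).mono ?_, fun f => ?_⟩
  · rintro _ ⟨x, rfl⟩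
    exact ⟨s x, ⟨x, rfl⟩, rfl⟩
  · have : (fun x => φ (s x)) ⁻¹' {f} = ⋃ a ∈ range s, s ⁻¹' {a} ∩ {_x | φ a = f} := by
      ext x
      simp only [mem_preimage, mem_iUnion, mem_inter_iff, mem_singleton_iff, exists_prop]
      exact ⟨fun h => ⟨s x, ⟨x, rfl⟩, rfl, h⟩, by rintro ⟨a, -, rfl, h⟩; exact h⟩
    rw [this]
    exact MeasurableSet.biUnion hs.1 fun a _ => (hs.2 a).inter (MeasurableSet.const _)

theorem IsSimple.ae {s : M → F.domain} (hs : F.IsSimple s) {P : F.domain → M → Prop}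
    (h : ∀ f, ∀ᵐ x ∂m, P f x) : ∀ᵐ x ∂m, P (s x) x := by
  have : ∀ᵐ x ∂m, ∀ f ∈ range s, P f x := (ae_ball_iff hs.1).2 fun f _ => h f
  exact this.mono fun x hx => hx _ ⟨x, rfl⟩

theorem pointwiseNorm_nonneg {s : M → F.domain} (hs : F.IsSimple s) :
    ∀ᵐ x ∂m, 0 ≤ F.pointwiseNorm s x :=
  hs.ae (P := fun f x => 0 ≤ F.val f x) fun f => (Lp.coeFn_nonneg _).2 (F.val_nonneg f)

theorem pointwiseNorm_smul {s : M → F.domain} (hs : F.IsSimple s) (c : ℝ) :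
    F.pointwiseNorm (c • s) =ᵐ[m] |c| • F.pointwiseNorm s := by
  refine hs.ae (P := fun f x => F.val (c • f) x = |c| • F.val f x) fun f => ?_
  rw [F.val_smul]
  exact Lp.coeFn_smul _ _

theorem pointwiseNorm_add_le {s t : M → F.domain} (hs : F.IsSimple s) (ht : F.IsSimple t) :
    ∀ᵐ x ∂m, F.pointwiseNorm (s + t) x ≤ F.pointwiseNorm s x + F.pointwiseNorm t x := by
  have : ∀ᵐ x ∂m, ∀ f ∈ range s, F.val (f + t x) x ≤ F.val f x + F.val (t x) x := by
    refine (ae_ball_iff hs.1).2 fun f _ => ht.ae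
      (P := fun h x => F.val (f + h) x ≤ F.val f x + F.val h x) fun h => ?_
    filter_upwards [(Lp.coeFn_le _ _).2 (F.val_add_le f h), Lp.coeFn_add (F.val f) (F.val h)]
      with x h1 h2
    rwa [h2] at h1
  exact this.mono fun x hx => hx _ ⟨x, rfl⟩

theorem norm_pointwiseNorm_add_le {s t : M → F.domain} (hs : F.IsSimple s) (ht : F.IsSimple t) :
    ∀ᵐ x ∂m, ‖F.pointwiseNorm (s + t) x‖ ≤ ‖(F.pointwiseNorm s + F.pointwiseNorm t) x‖ := by
  filter_upwards [pointwiseNorm_add_le hs ht, pointwiseNorm_nonneg (hs.add ht)] with x h1 h2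
  rw [Pi.add_apply, Real.norm_of_nonneg h2, Real.norm_of_nonneg (h2.trans h1)]
  exact h1

variable (F)

/-- The pre-module: simple families whose pointwise norm is in `L^p(m)`. -/
def Pfm : Submodule ℝ (M → F.domain) where
  carrier := {s | F.IsSimple s ∧ MemLp (F.pointwiseNorm s) p m}
  add_mem' := by
    rintro s t ⟨hs, hs'⟩ ⟨ht, ht'⟩
    exact ⟨hs.add ht, (hs'.add ht').mono (hs.add ht).aesm (norm_pointwiseNorm_add_le hs ht)⟩
  zero_mem' := by
    have h0 : F.IsSimple 0 := ⟨(countable_singleton 0).mono (by rintro _ ⟨x, rfl⟩; rfl),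
      fun f => MeasurableSet.const ((0 : F.domain) = f)⟩
    have := pointwiseNorm_smul h0 0
    rw [zero_smul, abs_zero, zero_smul] at this
    exact ⟨h0, (memLp_congr_ae this).2 MemLp.zero⟩
  smul_mem' := by
    rintro c s ⟨hs, hs'⟩
    exact ⟨hs.comp (c • ·), (memLp_congr_ae (pointwiseNorm_smul hs c)).2 (hs'.const_smul _)⟩

variable [hp : Fact (1 ≤ p)]

/-- The seminorm `‖s‖ = ‖ |s| ‖_{L^p(m)}` on the pre-module. -/
def pfmSeminorm : Seminorm ℝ F.Pfm :=
  Seminorm.of (fun s => (eLpNorm (F.pointwiseNorm s.1) p m).toReal)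
    (fun s t => by
      rw [← ENNReal.toReal_add s.2.2.2.ne t.2.2.2.ne]
      refine ENNReal.toReal_mono (ENNReal.add_ne_top.2 ⟨s.2.2.2.ne, t.2.2.2.ne⟩) ?_
      exact (eLpNorm_mono_ae (norm_pointwiseNorm_add_le s.2.1 t.2.1)).trans
        (eLpNorm_add_le s.2.1.aesm t.2.1.aesm hp.out))
    (fun c s => by
      have := eLpNorm_congr_ae (p := p) (pointwiseNorm_smul s.2.1 c)
      simp only [Submodule.coe_smul]
      rw [this, eLpNorm_const_smul, ENNReal.toReal_mul]
      simp)

instance : SeminormedAddCommGroup F.Pfm :=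
  F.pfmSeminorm.toAddGroupSeminorm.toSeminormedAddCommGroup

instance : NormedSpace ℝ F.Pfm where
  norm_smul_le c s := (map_smul_eq_mul F.pfmSeminorm c s).le

/-- The module generated by the functional: the completion of the pre-module modulo the families
of norm zero. -/
abbrev GeneratedModule : Type _ := UniformSpace.Completion F.Pfm

end SublinearFunctional

end Module

/-! ### The cotangent module, the Cheeger energy and the main notions -/

section Main

variable {M : Type*} [MetricSpace M] [MeasurableSpace M] [BorelSpace M]

/-- The functional `f ↦ |Df|_{*,p}`. -/
def relaxedFunctional (m : Measure M) [SigmaFinite m] (p : ℝ≥0∞) [Fact (1 < p)]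
    [Fact (p < ⊤)] : SublinearFunctional m p where
  domain := relaxedDomain m p
  val := relaxedSlope
  val_nonneg := relaxedSlope_nonneg
  val_add_le := relaxedSlope_add_le
  val_smul := relaxedSlope_smul

/-- The `L^p`-cotangent module `L^p(T^*M)`, as a Banach space. -/
abbrev CotangentModule (m : Measure M) [SigmaFinite m] (p : ℝ≥0∞) [Fact (1 < p)]
    [Fact (p < ⊤)] : Type _ :=
  (relaxedFunctional m p).GeneratedModule

open scoped Classical in
/-- The Cheeger energy on `L⁰(m)`: `∫ |Df|_{*,2}² dm` on the domain of the relaxed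
functional with `p = 2`, and `∞` elsewhere. -/
def cheegerEnergy (m : Measure M) [SigmaFinite m] (f : M →ₘ[m] ℝ) : ℝ≥0∞ :=
  if hf : f ∈ relaxedDomain m 2 then
    ∫⁻ x, ENNReal.ofReal (relaxedSlope (⟨f, hf⟩ : relaxedDomain m 2) x) ^ 2 ∂m
  else ⊤

/-- An extended-real-valued functional on a real vector space is a quadratic form. -/
def IsQuadraticForm {V : Type*} [AddCommGroup V] [Module ℝ V] (E : V → ℝ≥0∞) : Prop :=
  (∀ f g, E (f + g) + E (f - g) = 2 * E f + 2 * E g) ∧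
    ∀ (c : ℝ) (f), E (c • f) = ENNReal.ofReal (c ^ 2) * E f

/-- `(M, d, m)` is infinitesimally Riemannian: `f ↦ (lip f)²` is quadratic a.e. on Lipschitz
functions. -/
def InfinitesimallyRiemannian (m : Measure M) : Prop :=
  ∀ f g : M → ℝ, IsLip f → IsLip g →
    ∀ᵐ x ∂m, lip (f + g) x ^ 2 + lip (f - g) x ^ 2 = 2 * lip f x ^ 2 + 2 * lip g x ^ 2

/-- `(M, d, m)` is infinitesimally Hilbertian: the Cheeger energy is a quadratic form. -/
def InfinitesimallyHilbertian (m : Measure M) [SigmaFinite m] : Prop :=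
  IsQuadraticForm (cheegerEnergy m)

/-- A measure that is finite on bounded sets. -/
class FiniteOnBounded (m : Measure M) : Prop where
  lt_top : ∀ s : Set M, Bornology.IsBounded s → m s < ⊤

instance (m : Measure M) [h : FiniteOnBounded m] : SigmaFinite m := by
  rcases isEmpty_or_nonempty M with hM | ⟨⟨x₀⟩⟩
  · rw [Measure.eq_zero_of_isEmpty m]
    infer_instance
  · exact ⟨⟨{ set := fun n => Metric.ball x₀ n
              set_mem := fun _ => trivial
              finite := fun n => h.lt_top _ Metric.isBounded_ball
              spanning := Metric.iUnion_ball_nat x₀ }⟩⟩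

/-- Reflexivity of a normed space: the canonical map to the bidual is onto. -/
def IsReflexiveSpace (X : Type*) [NormedAddCommGroup X] [NormedSpace ℝ X] : Prop :=
  Function.Surjective (NormedSpace.inclusionInDoubleDual ℝ X)

end Main

end MetricSobolev

end

namespace MetricSobolev

/-! ### The Milman–Pettis theorem -/

section MilmanPettis

/-- A quantitative form of uniform convexity, with the `q`-th power of the norm. In contrast to
the usual formulations it is stable under completion. -/
def PowerUniformlyConvex (X : Type*) [SeminormedAddCommGroup X] [NormedSpace ℝ X] (q : ℝ) :
    Prop :=
  ∀ ε > 0, ∃ C > 0, ∀ x y : X, ‖x - y‖ ^ q ≤ ε * (‖x‖ ^ q + ‖y‖ ^ q)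
    + C * ((‖x‖ ^ q + ‖y‖ ^ q) / 2 - ‖(1 / 2 : ℝ) • (x + y)‖ ^ q)

theorem PowerUniformlyConvex.completion {X : Type*} [SeminormedAddCommGroup X] [NormedSpace ℝ X]
    {q : ℝ} (hq : 0 ≤ q) (h : PowerUniformlyConvex X q) :
    PowerUniformlyConvex (UniformSpace.Completion X) q := by
  intro ε hε
  obtain ⟨C, hC, hX⟩ := h ε hε
  have hr := Real.continuous_rpow_const hq
  refine ⟨C, hC, fun x y => UniformSpace.Completion.induction_on₂ x y ?_ fun a b => ?_⟩
  · set Z := UniformSpace.Completion X × UniformSpace.Completion X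
    have h0 : Continuous fun z : Z => ‖z.1 - z.2‖ ^ q :=
      hr.comp (continuous_fst.sub continuous_snd).norm
    have h1 : Continuous fun z : Z => ‖z.1‖ ^ q := hr.comp continuous_fst.norm
    have h2 : Continuous fun z : Z => ‖z.2‖ ^ q := hr.comp continuous_snd.norm
    have h3 : Continuous fun z : Z => ‖(1 / 2 : ℝ) • (z.1 + z.2)‖ ^ q :=
      hr.comp ((continuous_fst.add continuous_snd).const_smul (1 / 2 : ℝ)).norm
    exact isClosed_le h0 (((h1.add h2).const_mul ε).add
      ((((h1.add h2).div_const 2).sub h3).const_mul C))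
  · simpa only [← UniformSpace.Completion.coe_add, ← UniformSpace.Completion.coe_sub,
      ← UniformSpace.Completion.coe_smul, UniformSpace.Completion.norm_coe] using hX a b

variable {X : Type*} [NormedAddCommGroup X] [NormedSpace ℝ X]

theorem PowerUniformlyConvex.exists_forall_norm_sub_lt {q : ℝ} (hq : 0 < q)
    (h : PowerUniformlyConvex X q) {η : ℝ} (hη : 0 < η) :
    ∃ δ > 0, ∀ x y : X, ‖x‖ ≤ 1 → ‖y‖ ≤ 1 → 1 - δ < ‖(1 / 2 : ℝ) • (x + y)‖ → ‖x - y‖ < η := by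
  have hηq := Real.rpow_pos_of_pos hη q
  obtain ⟨C, hC, hX⟩ := h (η ^ q / 4) (by positivity)
  have hlim : Tendsto (fun t : ℝ => (1 - t) ^ q) (𝓝[>] 0) (𝓝 ((1 - 0) ^ q)) :=
    (((Real.continuous_rpow_const hq.le).comp (continuous_const.sub continuous_id)).tendsto
      0).mono_left nhdsWithin_le_nhds
  rw [sub_zero, Real.one_rpow] at hlim
  have hlt : 1 - η ^ q / (4 * C) < 1 := by
    have : 0 < η ^ q / (4 * C) := by positivity
    linarith
  obtain ⟨δ, hδ, hδ1, hδ0⟩ := ((hlim.eventually (lt_mem_nhds hlt)).and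
    (((gt_mem_nhds one_pos).filter_mono nhdsWithin_le_nhds).and
      eventually_mem_nhdsWithin)).exists
  rw [mem_Ioi] at hδ0
  refine ⟨δ, hδ0, fun x y hx hy hxy => ?_⟩
  have h1 : ‖x‖ ^ q ≤ 1 := Real.rpow_le_one (norm_nonneg _) hx hq.le
  have h2 : ‖y‖ ^ q ≤ 1 := Real.rpow_le_one (norm_nonneg _) hy hq.le
  have h3 : (1 - δ) ^ q ≤ ‖(1 / 2 : ℝ) • (x + y)‖ ^ q :=
    Real.rpow_le_rpow (by linarith) hxy.le hq.le
  have h4 : C * ((‖x‖ ^ q + ‖y‖ ^ q) / 2 - ‖(1 / 2 : ℝ) • (x + y)‖ ^ q)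
      ≤ C * (η ^ q / (4 * C)) := by
    gcongr
    linarith
  have h5 : C * (η ^ q / (4 * C)) = η ^ q / 4 := by field_simp
  have h6 : η ^ q / 4 * (‖x‖ ^ q + ‖y‖ ^ q) ≤ η ^ q / 4 * 2 := by
    gcongr
    linarith
  refine (Real.rpow_lt_rpow_iff (norm_nonneg _) hη.le hq).1 ?_
  linarith [hX x y]

theorem exists_ultrafilter_tendsto_of_convex {E F V : Type*} [AddCommGroup E] [Module ℝ E]
    [AddCommGroup F] [Module ℝ F] [AddCommGroup V] [Module ℝ V] (b : E →ₗ[ℝ] F →ₗ[ℝ] ℝ)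
    (j : V →ₗ[ℝ] E) {S : Set V} (hS : Convex ℝ S) (ξ : E)
    (h : ∀ (φ : F) (s : ℝ), (∀ x ∈ S, b (j x) φ < s) → b ξ φ ≤ s) :
    ∃ U : Ultrafilter V, S ∈ U ∧ ∀ φ, Tendsto (fun x => b (j x) φ) U (𝓝 (b ξ φ)) := by
  let j' : V →ₗ[ℝ] WeakBilin b := j
  let ξ' : WeakBilin b := ξ
  have hcl : ξ' ∈ closure (j' '' S) := by
    by_contra hcon
    obtain ⟨f, s, hs1, hs2⟩ := geometric_hahn_banach_closed_point
      (hS.linear_image j').closure isClosed_closure hcon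
    obtain ⟨φ, rfl⟩ := LinearMap.dualEmbedding_surjective _ f
    exact absurd (h φ s fun x hx => hs1 (j' x) (subset_closure ⟨x, hx, rfl⟩)) (not_le.2 hs2)
  obtain ⟨W, hW, hWξ⟩ := mem_closure_iff_ultrafilter.1 hcl
  refine ⟨Ultrafilter.ofComapInfPrincipal hW, Ultrafilter.ofComapInfPrincipal_mem hW,
    fun φ => ?_⟩
  have hmap : Tendsto j' (Ultrafilter.ofComapInfPrincipal hW : Ultrafilter V) (𝓝 ξ') := by
    have := Ultrafilter.ofComapInfPrincipal_eq_of_map hW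
    rw [Tendsto, ← Ultrafilter.coe_map, this]
    exact hWξ
  exact ((WeakBilin.eval_continuous b φ).tendsto ξ').comp hmap

/-- A form of Goldstine's theorem. -/
theorem exists_ultrafilter_tendsto_dual (ξ : StrongDual ℝ (StrongDual ℝ X)) (hξ : ‖ξ‖ ≤ 1) :
    ∃ U : Ultrafilter X, Metric.closedBall (0 : X) 1 ∈ U ∧
      ∀ φ : StrongDual ℝ X, Tendsto φ U (𝓝 (ξ φ)) := by
  refine exists_ultrafilter_tendsto_of_convex (topDualPairing ℝ (StrongDual ℝ X))
    (NormedSpace.inclusionInDoubleDual ℝ X).toLinearMap (convex_closedBall 0 1) ξ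
    fun φ s h => ?_
  have h1 : ∀ x : X, ‖x‖ ≤ 1 → φ x < s := fun x hx => h x (by simpa using hx)
  have h3 : ‖φ‖ ≤ s := by
    have h0 := h1 0 (by simp)
    rw [map_zero] at h0
    refine φ.opNorm_le_of_unit_norm h0.le fun x hx => ?_
    rw [Real.norm_eq_abs, abs_le]
    have := h1 (-x) (by rw [norm_neg, hx])
    rw [map_neg] at this
    exact ⟨by linarith, (h1 x hx.le).le⟩
  exact (Real.le_norm_self _).trans ((ξ.le_opNorm φ).trans
    ((mul_le_of_le_one_left (norm_nonneg _) hξ).trans h3))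

theorem norm_inv_norm_smul {Z : Type*} [SeminormedAddCommGroup Z] [NormedSpace ℝ Z] (z : Z)
    (hz : ‖z‖ ≠ 0) : ‖‖z‖⁻¹ • z‖ = 1 := by
  rw [norm_smul, norm_inv, norm_norm, inv_mul_cancel₀ hz]

/-- **Milman–Pettis theorem**: a uniformly convex Banach space is reflexive. -/
theorem PowerUniformlyConvex.isReflexiveSpace [CompleteSpace X] {q : ℝ} (hq : 0 < q)
    (h : PowerUniformlyConvex X q) : IsReflexiveSpace X := by
  have key : ∀ ξ : StrongDual ℝ (StrongDual ℝ X), ‖ξ‖ = 1 →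
      ∃ x, NormedSpace.inclusionInDoubleDual ℝ X x = ξ := by
    intro ξ hξ
    obtain ⟨U, hUB, hU⟩ := exists_ultrafilter_tendsto_dual ξ hξ.le
    have hcau : Cauchy (U : Filter X) := by
      refine Metric.cauchy_iff.2 ⟨inferInstance, fun η hη => ?_⟩
      obtain ⟨δ, hδ, hX⟩ := h.exists_forall_norm_sub_lt hq hη
      obtain ⟨φ, hφ, hφξ⟩ : ∃ φ : StrongDual ℝ X, ‖φ‖ ≤ 1 ∧ 1 - δ < ξ φ := by
        obtain ⟨φ, hφ, hφξ⟩ := ξ.exists_lt_apply_of_lt_opNorm (r := 1 - δ) (by linarith)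
        rw [Real.norm_eq_abs, lt_abs] at hφξ
        rcases hφξ with h1 | h1
        · exact ⟨φ, hφ.le, h1⟩
        · exact ⟨-φ, by rw [norm_neg]; exact hφ.le, by rwa [map_neg]⟩
      refine ⟨_, inter_mem hUB ((hU φ).eventually (lt_mem_nhds hφξ)), ?_⟩
      rintro x ⟨hx, hx'⟩ y ⟨hy, hy'⟩
      rw [mem_closedBall_zero_iff] at hx hy
      rw [mem_ofPred_eq] at hx' hy'
      rw [dist_eq_norm]
      refine hX x y hx hy ?_
      calc 1 - δ < φ ((1 / 2 : ℝ) • (x + y)) := by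
            rw [map_smul, map_add, smul_eq_mul]
            linarith
        _ ≤ ‖φ ((1 / 2 : ℝ) • (x + y))‖ := Real.le_norm_self _
        _ ≤ ‖(1 / 2 : ℝ) • (x + y)‖ :=
            (φ.le_opNorm _).trans (mul_le_of_le_one_left (norm_nonneg _) hφ)
    obtain ⟨x, hx⟩ := CompleteSpace.complete hcau
    refine ⟨x, ?_⟩
    ext φ
    exact tendsto_nhds_unique ((φ.continuous.tendsto x).mono_left hx) (hU φ)
  intro ξ
  rcases eq_or_ne ξ 0 with rfl | hξ
  · exact ⟨0, map_zero _⟩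
  · have hξ' : ‖ξ‖ ≠ 0 := fun h0 => hξ (ξ.opNorm_zero_iff.1 h0)
    obtain ⟨x, hx⟩ := key (‖ξ‖⁻¹ • ξ) (norm_inv_norm_smul ξ hξ')
    refine ⟨‖ξ‖ • x, ?_⟩
    rw [map_smul, hx, smul_smul, mul_inv_cancel₀ hξ', one_smul]

/-- In a reflexive space, a bounded family converges weakly along any ultrafilter. -/
theorem IsReflexiveSpace.exists_tendsto_ultrafilter (h : IsReflexiveSpace X) {ι : Type*}
    (U : Ultrafilter ι) {a : ι → X} {B : ℝ} (ha : ∀ i, ‖a i‖ ≤ B) :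
    ∃ x, ∀ φ : StrongDual ℝ X, Tendsto (fun i => φ (a i)) U (𝓝 (φ x)) := by
  have hex : ∀ φ : StrongDual ℝ X, ∃ y, ‖y‖ ≤ B * ‖φ‖ ∧ Tendsto (fun i => φ (a i)) U (𝓝 y) := by
    intro φ
    have hb : ∀ i, φ (a i) ∈ Metric.closedBall (0 : ℝ) (B * ‖φ‖) := fun i => by
      rw [mem_closedBall_zero_iff, mul_comm]
      exact φ.le_of_opNorm_le_of_le le_rfl (ha i)
    obtain ⟨y, hy, hy'⟩ := (isCompact_closedBall (0 : ℝ) (B * ‖φ‖)).ultrafilter_le_nhds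
      (U.map fun i => φ (a i)) (by
        rw [le_principal_iff]
        exact Ultrafilter.mem_map.2 (Filter.mem_of_superset univ_mem fun i _ => hb i))
    exact ⟨y, by simpa using hy, hy'⟩
  choose L hLb hL using hex
  obtain ⟨x, hx⟩ := h (LinearMap.mkContinuous
    { toFun := L
      map_add' := fun φ ψ => tendsto_nhds_unique (hL (φ + ψ)) ((hL φ).add (hL ψ))
      map_smul' := fun c φ => tendsto_nhds_unique (hL (c • φ)) ((hL φ).const_smul c) } B hLb)
  refine ⟨x, fun φ => ?_⟩
  have : φ x = L φ := congrArg (fun ξ : StrongDual ℝ (StrongDual ℝ X) => ξ φ) hx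
  rw [this]
  exact hL φ

/-- **Mazur's lemma**: a closed convex set is weakly closed. -/
theorem mem_closure_of_tendsto_weakly {S : Set X} (hS : Convex ℝ S) {ι : Type*}
    {l : Filter ι} [l.NeBot] {a : ι → X} {x : X} (haS : ∀ᶠ i in l, a i ∈ S)
    (ha : ∀ φ : StrongDual ℝ X, Tendsto (fun i => φ (a i)) l (𝓝 (φ x))) : x ∈ closure S := by
  by_contra hcon
  obtain ⟨φ, s, hs1, hs2⟩ := geometric_hahn_banach_point_closed hS.closure isClosed_closure hcon
  have := ge_of_tendsto (ha φ) (haS.mono fun i hi => (hs2 _ (subset_closure hi)).le)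
  linarith

end MilmanPettis

/-! ### Uniform convexity from a pointwise parallelogram inequality -/

section Parallelogram

theorem half_rpow_le_average {q : ℝ} (hq : 1 < q) {t : ℝ} (ht : t ∈ Icc (0 : ℝ) 1) :
    (1 / 2 : ℝ) ^ q ≤ (t ^ q + (1 - t) ^ q) / 2 := by
  have := (convexOn_rpow hq.le).2 (show t ∈ Ici (0 : ℝ) from ht.1)
    (show 1 - t ∈ Ici (0 : ℝ) by simpa using ht.2) (show (0 : ℝ) ≤ 1 / 2 by norm_num)
    (show (0 : ℝ) ≤ 1 / 2 by norm_num) (by norm_num)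
  simp only [smul_eq_mul] at this
  rw [show (1 / 2 * t + 1 / 2 * (1 - t) : ℝ) = 1 / 2 by ring] at this
  linarith

theorem half_rpow_lt_average {q : ℝ} (hq : 1 < q) {t : ℝ} (ht : t ∈ Icc (0 : ℝ) 1)
    (hne : t ≠ 1 - t) : (1 / 2 : ℝ) ^ q < (t ^ q + (1 - t) ^ q) / 2 := by
  have := (strictConvexOn_rpow hq).2 (show t ∈ Ici (0 : ℝ) from ht.1)
    (show 1 - t ∈ Ici (0 : ℝ) by simpa using ht.2) hne (show (0 : ℝ) < 1 / 2 by norm_num)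
    (show (0 : ℝ) < 1 / 2 by norm_num) (by norm_num)
  simp only [smul_eq_mul] at this
  rw [show (1 / 2 * t + 1 / 2 * (1 - t) : ℝ) = 1 / 2 by ring] at this
  linarith

theorem exists_rpow_le_of_parallelogram_normalized {q : ℝ} (hq : 1 < q) {ε : ℝ} (hε : 0 < ε) :
    ∃ C > 0, ∀ t c d : ℝ, t ∈ Icc (0 : ℝ) 1 → c ∈ Icc (0 : ℝ) 1 → 0 ≤ d →
      c ^ 2 + d ^ 2 ≤ 2 * t ^ 2 + 2 * (1 - t) ^ 2 →
      d ^ q ≤ ε * (t ^ q + (1 - t) ^ q) + C * ((t ^ q + (1 - t) ^ q) / 2 - (c / 2) ^ q) := by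
  have hq0 : 0 ≤ q := by linarith
  have hr := Real.continuous_rpow_const hq0
  set h : ℝ × ℝ × ℝ → ℝ := fun z => (z.1 ^ q + (1 - z.1) ^ q) / 2 - (z.2.1 / 2) ^ q with hh
  have c1 : Continuous fun z : ℝ × ℝ × ℝ => z.1 ^ q := hr.comp continuous_fst
  have c2 : Continuous fun z : ℝ × ℝ × ℝ => (1 - z.1) ^ q :=
    hr.comp (continuous_const.sub continuous_fst)
  have c3 : Continuous fun z : ℝ × ℝ × ℝ => (z.2.1 / 2) ^ q := hr.comp (by fun_prop)
  have c4 : Continuous fun z : ℝ × ℝ × ℝ => z.2.2 ^ q := hr.comp (by fun_prop)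
  have hc : Continuous h := ((c1.add c2).div_const 2).sub c3
  set K : Set (ℝ × ℝ × ℝ) := Icc (0, 0, 0) (1, 1, 2) ∩
    ({z | z.2.1 ^ 2 + z.2.2 ^ 2 ≤ 2 * z.1 ^ 2 + 2 * (1 - z.1) ^ 2} ∩
      {z | ε * (z.1 ^ q + (1 - z.1) ^ q) ≤ z.2.2 ^ q}) with hK
  have hKc : IsCompact K := isCompact_Icc.inter_right
    ((isClosed_le (by fun_prop) (by fun_prop)).inter
      (isClosed_le ((c1.add c2).const_mul ε) c4))
  have hcq : ∀ c ∈ Icc (0 : ℝ) 1, (c / 2) ^ q ≤ (1 / 2 : ℝ) ^ q := fun c hc =>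
    Real.rpow_le_rpow (by linarith [hc.1]) (by linarith [hc.2]) hq0
  have hpos : ∀ z ∈ K, 0 < h z := by
    rintro ⟨t, c, d⟩ ⟨⟨⟨ht0, hc0, hd0⟩, ⟨ht1, hc1, hd1⟩⟩, hpar, hbig⟩
    simp only [mem_ofPred_eq] at ht0 hc0 hd0 ht1 hc1 hd1 hpar hbig
    simp only [hh]
    by_cases hne : t = 1 - t
    · have ht : t = 1 / 2 := by linarith
      subst ht
      rw [show (1 - 1 / 2 : ℝ) = 1 / 2 by norm_num] at hbig hpar ⊢
      have hhalf : (0 : ℝ) < (1 / 2) ^ q := Real.rpow_pos_of_pos (by norm_num) q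
      have hlt : c < 1 := by
        refine lt_of_le_of_ne hc1 fun hc => ?_
        rw [hc] at hpar
        have hd : d = 0 := by
          have : d ^ 2 ≤ 0 := by linarith
          exact pow_eq_zero_iff two_ne_zero |>.1 (le_antisymm this (sq_nonneg d))
        rw [hd, Real.zero_rpow (by linarith)] at hbig
        have : 0 < ε * ((1 / 2 : ℝ) ^ q + (1 / 2) ^ q) := by positivity
        linarith
      have : (c / 2) ^ q < (1 / 2 : ℝ) ^ q :=
        Real.rpow_lt_rpow (by linarith) (by linarith) (by linarith)
      linarith
    · have := half_rpow_lt_average hq ⟨ht0, ht1⟩ hne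
      have := hcq c ⟨hc0, hc1⟩
      linarith
  obtain ⟨r, hr0, hrK⟩ : ∃ r > 0, ∀ z ∈ K, r ≤ h z := by
    rcases K.eq_empty_or_nonempty with he | hne
    · exact ⟨1, one_pos, by simp [he]⟩
    · obtain ⟨z, hz, hmin⟩ := hKc.exists_isMinOn hne hc.continuousOn
      exact ⟨h z, hpos z hz, fun w hw => hmin hw⟩
  have h2q : (0 : ℝ) < 2 ^ q := Real.rpow_pos_of_pos two_pos q
  refine ⟨2 ^ q / r, by positivity, fun t c d ht hc hd hpar => ?_⟩
  have hd2 : d ≤ 2 := by nlinarith [ht.1, ht.2, sq_nonneg c]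
  have hn1 : 0 ≤ t ^ q := Real.rpow_nonneg ht.1 q
  have hn2 : 0 ≤ (1 - t) ^ q := Real.rpow_nonneg (by linarith [ht.2]) q
  have hn3 : 0 ≤ ε * (t ^ q + (1 - t) ^ q) := by positivity
  by_cases hz : ε * (t ^ q + (1 - t) ^ q) ≤ d ^ q
  · have h1 := hrK (t, c, d) ⟨⟨⟨ht.1, hc.1, hd⟩, ⟨ht.2, hc.2, hd2⟩⟩, hpar, hz⟩
    have h2 : d ^ q ≤ 2 ^ q := Real.rpow_le_rpow hd hd2 hq0
    have h3 : 2 ^ q ≤ 2 ^ q / r * h (t, c, d) := by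
      calc (2 : ℝ) ^ q = 2 ^ q / r * r := by field_simp
        _ ≤ 2 ^ q / r * h (t, c, d) := by gcongr
    exact (h2.trans h3).trans (le_add_of_nonneg_left hn3)
  · have h1 : 0 ≤ (t ^ q + (1 - t) ^ q) / 2 - (c / 2) ^ q := by
      linarith [half_rpow_le_average hq ht, hcq c hc]
    have : 0 ≤ 2 ^ q / r * ((t ^ q + (1 - t) ^ q) / 2 - (c / 2) ^ q) := by positivity
    linarith

/-- The four numbers `a, b, c, d` play the roles of the norms of `x, y, x + y, x - y`. -/
theorem exists_rpow_le_of_parallelogram {q : ℝ} (hq : 1 < q) {ε : ℝ} (hε : 0 < ε) :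
    ∃ C > 0, ∀ a b c d : ℝ, 0 ≤ a → 0 ≤ b → 0 ≤ c → 0 ≤ d → c ≤ a + b →
      c ^ 2 + d ^ 2 ≤ 2 * a ^ 2 + 2 * b ^ 2 →
      d ^ q ≤ ε * (a ^ q + b ^ q) + C * ((a ^ q + b ^ q) / 2 - (c / 2) ^ q) := by
  obtain ⟨C, hC, main⟩ := exists_rpow_le_of_parallelogram_normalized hq hε
  refine ⟨C, hC, fun a b c d ha hb hc hd hcab hpar => ?_⟩
  have hq0 : q ≠ 0 := by linarith
  rcases (add_nonneg ha hb).eq_or_lt with h0 | h0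
  · have ha0 : a = 0 := by linarith
    have hb0 : b = 0 := by linarith
    have hc0 : c = 0 := by linarith
    subst ha0 hb0 hc0
    have hd0 : d = 0 := by nlinarith
    simp [hd0, Real.zero_rpow hq0]
  · set s := a + b with hs
    have e1 : 1 - a / s = b / s := by field_simp; simp only [s]; ring
    have hpar' : (c / s) ^ 2 + (d / s) ^ 2 ≤ 2 * (a / s) ^ 2 + 2 * (1 - a / s) ^ 2 := by
      rw [e1]
      simp only [div_pow]
      rw [← add_div, mul_div_assoc', mul_div_assoc', ← add_div]
      gcongr
    have hm := main (a / s) (c / s) (d / s)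
      ⟨by positivity, by rw [div_le_one h0]; linarith⟩
      ⟨by positivity, by rwa [div_le_one h0]⟩ (by positivity) hpar'
    rw [e1, div_right_comm c s 2, Real.div_rpow hd h0.le, Real.div_rpow ha h0.le,
      Real.div_rpow hb h0.le, Real.div_rpow (by positivity) h0.le] at hm
    have hsq : 0 < s ^ q := Real.rpow_pos_of_pos h0 q
    have := mul_le_mul_of_nonneg_left hm hsq.le
    rw [mul_div_cancel₀ _ hsq.ne'] at this
    refine this.trans (le_of_eq ?_)
    field_simp

variable {M : Type*} [MeasurableSpace M] {m : Measure M} {p : ℝ≥0∞} [h1 : Fact (1 < p)]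
  [h2 : Fact (p < ⊤)]

theorem exists_Lp_norm_rpow_le_of_parallelogram {ε : ℝ} (hε : 0 < ε) :
    ∃ C > 0, ∀ a b c d : Lp ℝ p m, 0 ≤ a → 0 ≤ b → 0 ≤ c → 0 ≤ d → c ≤ a + b →
      (∀ᵐ x ∂m, c x ^ 2 + d x ^ 2 ≤ 2 * a x ^ 2 + 2 * b x ^ 2) →
      ‖d‖ ^ p.toReal ≤ ε * (‖a‖ ^ p.toReal + ‖b‖ ^ p.toReal)
        + C * ((‖a‖ ^ p.toReal + ‖b‖ ^ p.toReal) / 2 - (‖c‖ / 2) ^ p.toReal) := by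
  obtain ⟨C, hC, hmain⟩ := exists_rpow_le_of_parallelogram (one_lt_toReal (p := p)) hε
  refine ⟨C, hC, fun a b c d ha hb hc hd hcab hpar => ?_⟩
  have hhalf : ‖c‖ / 2 = ‖(1 / 2 : ℝ) • c‖ := by
    rw [norm_smul]
    norm_num
    ring
  simp only [hhalf, Lp_norm_rpow]
  have hab : Integrable (fun x => ‖a x‖ ^ p.toReal + ‖b x‖ ^ p.toReal) m :=
    (Lp_integrable a).add (Lp_integrable b)
  have hI := Lp_integrable ((1 / 2 : ℝ) • c)
  have hJ : Integrable (fun x => (‖a x‖ ^ p.toReal + ‖b x‖ ^ p.toReal) / 2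
      - ‖((1 / 2 : ℝ) • c : Lp ℝ p m) x‖ ^ p.toReal) m := (hab.div_const 2).sub hI
  have E : ∫ x, (ε * (‖a x‖ ^ p.toReal + ‖b x‖ ^ p.toReal)
      + C * ((‖a x‖ ^ p.toReal + ‖b x‖ ^ p.toReal) / 2
        - ‖((1 / 2 : ℝ) • c : Lp ℝ p m) x‖ ^ p.toReal)) ∂m
      = ε * (∫ x, ‖a x‖ ^ p.toReal ∂m + ∫ x, ‖b x‖ ^ p.toReal ∂m)
      + C * ((∫ x, ‖a x‖ ^ p.toReal ∂m + ∫ x, ‖b x‖ ^ p.toReal ∂m) / 2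
        - ∫ x, ‖((1 / 2 : ℝ) • c : Lp ℝ p m) x‖ ^ p.toReal ∂m) := by
    rw [integral_add (hab.const_mul ε) (hJ.const_mul C),
      integral_const_mul, integral_const_mul, integral_sub (hab.div_const 2) hI, integral_div,
      integral_add (Lp_integrable a) (Lp_integrable b)]
  rw [← E]
  refine integral_mono_ae (Lp_integrable _)
    ((hab.const_mul ε).add (hJ.const_mul C)) ?_
  filter_upwards [(Lp.coeFn_nonneg a).2 ha, (Lp.coeFn_nonneg b).2 hb, (Lp.coeFn_nonneg c).2 hc,
    (Lp.coeFn_nonneg d).2 hd, (Lp.coeFn_le _ _).2 hcab, Lp.coeFn_add a b,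
    Lp.coeFn_smul (1 / 2 : ℝ) c, hpar] with x h1 h2 h3 h4 h5 h6 h7 h8
  simp only [Pi.zero_apply] at h1 h2 h3 h4
  rw [h6, Pi.add_apply] at h5
  have := hmain (a x) (b x) (c x) (d x) h1 h2 h3 h4 h5 h8
  simp only [h7, Pi.smul_apply, smul_eq_mul]
  rw [one_div_mul_eq_div, Real.norm_of_nonneg h1, Real.norm_of_nonneg h2,
    Real.norm_of_nonneg (by linarith : 0 ≤ c x / 2), Real.norm_of_nonneg h4]
  exact this

theorem powerUniformlyConvex_Lp : PowerUniformlyConvex (Lp ℝ p m) p.toReal := by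
  intro ε hε
  obtain ⟨C, hC, hmain⟩ := exists_Lp_norm_rpow_le_of_parallelogram (m := m) (p := p) hε
  refine ⟨C, hC, fun f g => ?_⟩
  have := hmain |f| |g| |f + g| |f - g| (abs_nonneg _) (abs_nonneg _) (abs_nonneg _)
    (abs_nonneg _) (abs_add_le _ _) (by
      filter_upwards [Lp.coeFn_abs f, Lp.coeFn_abs g, Lp.coeFn_abs (f + g), Lp.coeFn_abs (f - g),
        Lp.coeFn_add f g, Lp.coeFn_sub f g] with x h1 h2 h3 h4 h5 h6
      rw [h1, h2, h3, h4, h5, h6]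
      simp only [sq_abs, Pi.add_apply, Pi.sub_apply]
      exact le_of_eq (by ring))
  simp only [norm_abs_eq_norm] at this
  refine this.trans (le_of_eq ?_)
  rw [norm_smul]
  norm_num
  left
  ring_nf

theorem isReflexiveSpace_Lp : IsReflexiveSpace (Lp ℝ p m) :=
  powerUniformlyConvex_Lp.isReflexiveSpace (by linarith [one_lt_toReal (p := p)])

namespace SublinearFunctional

variable (F : SublinearFunctional m p)

theorem powerUniformlyConvex_pfm (hF : ∀ f g : F.domain, ∀ᵐ x ∂m,
      F.val (f + g) x ^ 2 + F.val (f - g) x ^ 2 ≤ 2 * F.val f x ^ 2 + 2 * F.val g x ^ 2) :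
    PowerUniformlyConvex F.Pfm p.toReal := by
  intro ε hε
  obtain ⟨C, hC, hmain⟩ := exists_Lp_norm_rpow_le_of_parallelogram (m := m) (p := p) hε
  have hnorm : ∀ s : F.Pfm, ‖MemLp.toLp (F.pointwiseNorm s.1) s.2.2‖ = ‖s‖ := fun s =>
    Lp.norm_toLp _ _
  have hnn : ∀ s : F.Pfm, 0 ≤ MemLp.toLp (F.pointwiseNorm s.1) s.2.2 := fun s => by
    rw [← Lp.coeFn_nonneg]
    filter_upwards [MemLp.coeFn_toLp s.2.2, pointwiseNorm_nonneg s.2.1] with x h1 h2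
    rwa [h1]
  refine ⟨C, hC, fun s t => ?_⟩
  have := hmain _ _ _ _ (hnn s) (hnn t) (hnn (s + t)) (hnn (s - t)) (by
      rw [← Lp.coeFn_le]
      filter_upwards [MemLp.coeFn_toLp s.2.2, MemLp.coeFn_toLp t.2.2,
        MemLp.coeFn_toLp (s + t).2.2, Lp.coeFn_add (MemLp.toLp _ s.2.2) (MemLp.toLp _ t.2.2),
        pointwiseNorm_add_le s.2.1 t.2.1] with x h1 h2 h3 h4 h5
      rw [h3, h4, Pi.add_apply, h1, h2]
      exact h5) (by
      have hpar : ∀ᵐ x ∂m, ∀ f ∈ range s.1, F.val (f + t.1 x) x ^ 2 + F.val (f - t.1 x) x ^ 2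
          ≤ 2 * F.val f x ^ 2 + 2 * F.val (t.1 x) x ^ 2 :=
        (ae_ball_iff s.2.1.1).2 fun f _ => t.2.1.ae
          (P := fun g x => F.val (f + g) x ^ 2 + F.val (f - g) x ^ 2
            ≤ 2 * F.val f x ^ 2 + 2 * F.val g x ^ 2) fun g => hF f g
      filter_upwards [MemLp.coeFn_toLp s.2.2, MemLp.coeFn_toLp t.2.2,
        MemLp.coeFn_toLp (s + t).2.2, MemLp.coeFn_toLp (s - t).2.2, hpar] with x h1 h2 h3 h4 h5
      rw [h1, h2, h3, h4]
      exact h5 _ ⟨x, rfl⟩)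
  simp only [hnorm] at this
  refine this.trans (le_of_eq ?_)
  rw [norm_smul]
  norm_num
  left
  ring_nf

theorem isReflexiveSpace_generatedModule (hF : ∀ f g : F.domain, ∀ᵐ x ∂m,
      F.val (f + g) x ^ 2 + F.val (f - g) x ^ 2 ≤ 2 * F.val f x ^ 2 + 2 * F.val g x ^ 2) :
    IsReflexiveSpace F.GeneratedModule := by
  have hq := one_lt_toReal (p := p)
  exact ((F.powerUniformlyConvex_pfm hF).completion (by linarith)).isReflexiveSpace (by linarith)

end SublinearFunctional

end Parallelogram

/-! ### The pointwise parallelogram inequality for relaxed slopes -/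

section RelaxedParallelogram

variable {M : Type*} [MetricSpace M] [MeasurableSpace M] [BorelSpace M]
  {m : Measure M} {p : ℝ≥0∞} [h1 : Fact (1 < p)]

/-- Convex combinations turn a weak upper bound for the slopes into a strong one. -/
theorem exists_slopeLp_le_tendsto {f : M → ℝ} (u : ℕ → lipDomain m p) (w : ℕ → Lp ℝ p m)
    (hu : ∀ᵐ x ∂m, Tendsto (fun n => (u n : M → ℝ) x) atTop (𝓝 (f x)))
    (huw : ∀ n, slopeLp (u n) ≤ w n) {l : Filter ℕ} [l.NeBot] (hl : l ≤ atTop) {G : Lp ℝ p m}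
    (hw : ∀ φ : StrongDual ℝ (Lp ℝ p m), Tendsto (fun n => φ (w n)) l (𝓝 (φ G))) :
    ∃ (v : ℕ → lipDomain m p) (c : ℕ → Lp ℝ p m),
      (∀ᵐ x ∂m, Tendsto (fun n => (v n : M → ℝ) x) atTop (𝓝 (f x))) ∧
      (∀ n, slopeLp (v n) ≤ c n) ∧ Tendsto c atTop (𝓝 G) := by
  set C : ℕ → Set (lipDomain m p × Lp ℝ p m) := fun n =>
    convexHull ℝ ((fun k => (u k, w k)) '' Ici n) with hC
  have hCsub : ∀ {n : ℕ} {T : Set (lipDomain m p × Lp ℝ p m)}, Convex ℝ T →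
      (∀ k, n ≤ k → (u k, w k) ∈ T) → C n ⊆ T := by
    intro n T hT h
    refine convexHull_min ?_ hT
    rintro _ ⟨k, hk, rfl⟩
    exact h k hk
  have hslope : ∀ n, ∀ v ∈ C n, slopeLp v.1 ≤ v.2 := by
    intro n
    refine hCsub (T := {v | slopeLp v.1 ≤ v.2}) ?_ fun k _ => huw k
    intro v hv v' hv' a b ha hb _
    calc slopeLp (a • v.1 + b • v'.1) ≤ slopeLp (a • v.1) + slopeLp (b • v'.1) :=
          slopeLp_add_le _ _
      _ = a • slopeLp v.1 + b • slopeLp v'.1 := by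
          rw [slopeLp_smul, slopeLp_smul, abs_of_nonneg ha, abs_of_nonneg hb]
      _ ≤ a • v.2 + b • v'.2 := add_le_add (Lp_smul_le ha hv) (Lp_smul_le hb hv')
  have hex : ∀ n : ℕ, ∃ v ∈ C n, dist v.2 G < 1 / ((n : ℝ) + 1) := by
    intro n
    have hcl : G ∈ closure (Prod.snd '' C n) :=
      mem_closure_of_tendsto_weakly
        ((convex_convexHull ℝ _).linear_image (LinearMap.snd ℝ (lipDomain m p) (Lp ℝ p m)))
        (((eventually_ge_atTop n).filter_mono hl).mono fun k hk =>
          ⟨(u k, w k), subset_convexHull ℝ _ ⟨k, hk, rfl⟩, rfl⟩) hw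
    obtain ⟨_, ⟨v, hv, rfl⟩, hd⟩ := Metric.mem_closure_iff.1 hcl (1 / ((n : ℝ) + 1))
      (by positivity)
    exact ⟨v, hv, by rwa [dist_comm]⟩
  choose v hvC hvG using hex
  refine ⟨fun n => (v n).1, fun n => (v n).2, ?_, fun n => hslope n _ (hvC n), ?_⟩
  · filter_upwards [hu] with x hx
    rw [Metric.tendsto_atTop] at hx ⊢
    intro ε hε
    obtain ⟨n, hn⟩ := hx ε hε
    refine ⟨n, fun k hk => ?_⟩
    have hcv : Convex ℝ {v : lipDomain m p × Lp ℝ p m | (v.1 : M → ℝ) x ∈ Metric.ball (f x) ε} :=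
      (convex_ball (f x) ε).linear_preimage ((LinearMap.proj x).comp
        ((lipDomain m p).subtype.comp (LinearMap.fst ℝ (lipDomain m p) (Lp ℝ p m))))
    exact hCsub hcv (fun j hj => hn j (hk.trans hj)) (hvC k)
  · rw [tendsto_iff_dist_tendsto_zero]
    exact squeeze_zero (fun n => dist_nonneg) (fun n => (hvG n).le)
      tendsto_one_div_add_atTop_nhds_zero_nat

variable [SigmaFinite m]

theorem exists_dominated_of_mem_weakSlopeLimits {f : M → ℝ} {G : Lp ℝ p m}
    (hG : G ∈ weakSlopeLimits m p f) :
    ∃ (v : ℕ → lipDomain m p) (c : ℕ → Lp ℝ p m),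
      (∀ᵐ x ∂m, Tendsto (fun n => (v n : M → ℝ) x) atTop (𝓝 (f x))) ∧
      (∀ n, slopeLp (v n) ≤ c n) ∧ Tendsto c atTop (𝓝 G) := by
  obtain ⟨u, hu, huG⟩ := hG
  obtain ⟨φ, hφ, hφu⟩ := hu.exists_ae
  exact exists_slopeLp_le_tendsto (fun n => u (φ n)) _ hφu (fun n => le_rfl) le_rfl
    fun χ => (huG χ).comp hφ.tendsto_atTop

variable [h2 : Fact (p < ⊤)]

theorem relaxedSlope_le_of_tendsto_weakly (f : relaxedDomain m p) (u : ℕ → lipDomain m p)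
    (hu : ∀ᵐ x ∂m, Tendsto (fun n => (u n : M → ℝ) x) atTop (𝓝 ((f : M →ₘ[m] ℝ) x)))
    {l : Filter ℕ} [l.NeBot] (hl : l ≤ atTop) {A : Lp ℝ p m}
    (hA : ∀ φ : StrongDual ℝ (Lp ℝ p m), Tendsto (fun n => φ (slopeLp (u n))) l (𝓝 (φ A))) :
    relaxedSlope f ≤ A := by
  obtain ⟨v, c, hv, hvc, hc⟩ := exists_slopeLp_le_tendsto u _ hu (fun n => le_rfl) hl hA
  obtain ⟨B, hB⟩ := hc.norm.bddAbove_range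
  obtain ⟨G, hG, hGA⟩ := exists_weakSlopeLimit v c hv hvc (B := B) fun n => hB ⟨n, rfl⟩
  exact ((isGreatest_relaxedSlope f).1 hG).trans (hGA A (TendstoWeakly.of_tendsto hc))

end RelaxedParallelogram

section RelaxedParallelogram

theorem sq_add_sq_le_of_forall_rat {a b w : ℝ} (hw : 0 ≤ w)
    (h : ∀ i j : ℚ, i * a + j * b ≤ √((i : ℝ) ^ 2 + (j : ℝ) ^ 2) * w) :
    a ^ 2 + b ^ 2 ≤ w ^ 2 := by
  have hreal : ∀ z : ℝ × ℝ, z.1 * a + z.2 * b ≤ √(z.1 ^ 2 + z.2 ^ 2) * w := fun z =>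
    (Rat.denseRange_cast (𝕜 := ℝ).prodMap Rat.denseRange_cast).induction_on
      (p := fun z : ℝ × ℝ => z.1 * a + z.2 * b ≤ √(z.1 ^ 2 + z.2 ^ 2) * w) z
      (isClosed_le (by fun_prop) (by fun_prop)) fun q => h q.1 q.2
  have h1 := hreal (a, b)
  simp only at h1
  have h2 : √(a ^ 2 + b ^ 2) ^ 2 = a ^ 2 + b ^ 2 := Real.sq_sqrt (by positivity)
  have h3 : √(a ^ 2 + b ^ 2) ≤ w := by
    rcases (Real.sqrt_nonneg (a ^ 2 + b ^ 2)).eq_or_lt with h0 | h0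
    · rwa [← h0]
    · exact le_of_mul_le_mul_left (by linarith) h0
  rw [← h2]
  gcongr

theorem exists_continuous_sqrt_sq_add_sq {M : Type*} [MeasurableSpace M] (m : Measure M)
    (p : ℝ≥0∞) [Fact (1 ≤ p)] : ∃ N : Lp ℝ p m × Lp ℝ p m → Lp ℝ p m, Continuous N ∧
      ∀ c d, N (c, d) =ᵐ[m] fun x => √(c x ^ 2 + d x ^ 2) := by
  set L := Complex.ofRealCLM.compLpL p m
  have h1 : LipschitzWith 1 (norm : ℂ → ℝ) := lipschitzWith_one_norm
  refine ⟨fun z => h1.compLp norm_zero (L z.1 + Complex.I • L z.2),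
    (h1.continuous_compLp norm_zero).comp ((L.continuous.comp continuous_fst).add
      ((L.continuous.comp continuous_snd).const_smul Complex.I)), fun c d => ?_⟩
  filter_upwards [h1.coeFn_compLp norm_zero (L c + Complex.I • L d),
    Lp.coeFn_add (L c) (Complex.I • L d), Lp.coeFn_smul Complex.I (L d),
    Complex.ofRealCLM.coeFn_compLpL c, Complex.ofRealCLM.coeFn_compLpL d] with x e1 e2 e3 e4 e5
  rw [e1, Function.comp_apply, e2, Pi.add_apply, e3, Pi.smul_apply, e4, e5, smul_eq_mul, mul_comm]
  exact Complex.norm_add_mul_I _ _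

variable {M : Type*} [MetricSpace M] [MeasurableSpace M] [BorelSpace M]
  {m : Measure M} {p : ℝ≥0∞}

theorem InfinitesimallyRiemannian.slopeLp_sq_add_sq (hR : InfinitesimallyRiemannian m)
    (u v : lipDomain m p) : ∀ᵐ x ∂m, slopeLp (u + v) x ^ 2 + slopeLp (u - v) x ^ 2
      = 2 * slopeLp u x ^ 2 + 2 * slopeLp v x ^ 2 := by
  filter_upwards [hR u v u.2.1 v.2.1, slopeLp_coe u, slopeLp_coe v, slopeLp_coe (u + v),
    slopeLp_coe (u - v)] with x h h1 h2 h3 h4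
  rw [h1, h2, h3, h4]
  exact h

variable [h1 : Fact (1 < p)] [h2 : Fact (p < ⊤)] [SigmaFinite m]

theorem InfinitesimallyRiemannian.relaxedSlope_sq_le_of_mem (hR : InfinitesimallyRiemannian m)
    (f g : relaxedDomain m p) {G H : Lp ℝ p m} (hG : G ∈ weakSlopeLimits m p f)
    (hH : H ∈ weakSlopeLimits m p g) :
    ∀ᵐ x ∂m, relaxedSlope (f + g) x ^ 2 + relaxedSlope (f - g) x ^ 2
      ≤ 2 * G x ^ 2 + 2 * H x ^ 2 := by
  obtain ⟨N, hN, hNx⟩ := exists_continuous_sqrt_sq_add_sq m p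
  obtain ⟨u, c, hu, huc, hcG⟩ := exists_dominated_of_mem_weakSlopeLimits hG
  obtain ⟨v, d, hv, hvd, hdH⟩ := exists_dominated_of_mem_weakSlopeLimits hH
  have hu' : ∀ᵐ x ∂m, Tendsto (fun n => ((u n + v n : lipDomain m p) : M → ℝ) x) atTop
      (𝓝 (((f + g : relaxedDomain m p) : M →ₘ[m] ℝ) x)) := by
    filter_upwards [hu, hv, AEEqFun.coeFn_add (f : M →ₘ[m] ℝ) (g : M →ₘ[m] ℝ)] with x e1 e2 e3
    rw [Submodule.coe_add, e3]
    exact e1.add e2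
  have hv' : ∀ᵐ x ∂m, Tendsto (fun n => ((u n - v n : lipDomain m p) : M → ℝ) x) atTop
      (𝓝 (((f - g : relaxedDomain m p) : M →ₘ[m] ℝ) x)) := by
    filter_upwards [hu, hv, AEEqFun.coeFn_sub (f : M →ₘ[m] ℝ) (g : M →ₘ[m] ℝ)] with x e1 e2 e3
    rw [Submodule.coe_sub, e3]
    exact e1.sub e2
  set a : ℕ → Lp ℝ p m := fun n => slopeLp (u n + v n)
  set b : ℕ → Lp ℝ p m := fun n => slopeLp (u n - v n)
  set w : ℕ → Lp ℝ p m := fun n => √2 • N (c n, d n)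
  have hsqrt : √2 ^ 2 = (2 : ℝ) := Real.sq_sqrt zero_le_two
  have hwlim : Tendsto w atTop (𝓝 (√2 • N (G, H))) :=
    (((hN.tendsto (G, H)).comp (hcG.prodMk_nhds hdH))).const_smul (√2)
  have hW : ∀ c d : Lp ℝ p m, ∀ᵐ x ∂m, 0 ≤ (√2 • N (c, d) : Lp ℝ p m) x ∧
      (√2 • N (c, d) : Lp ℝ p m) x ^ 2 = 2 * c x ^ 2 + 2 * d x ^ 2 := by
    intro c d
    filter_upwards [hNx c d, Lp.coeFn_smul (√2) (N (c, d))] with x e1 e2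
    rw [e2, Pi.smul_apply, e1, smul_eq_mul, mul_pow, hsqrt, Real.sq_sqrt (by positivity)]
    exact ⟨by positivity, by ring⟩
  have hab : ∀ n, ∀ᵐ x ∂m, 0 ≤ a n x ∧ 0 ≤ b n x ∧ 0 ≤ w n x ∧
      a n x ^ 2 + b n x ^ 2 ≤ w n x ^ 2 := by
    intro n
    filter_upwards [hW (c n) (d n), hR.slopeLp_sq_add_sq (u n) (v n),
      (Lp.coeFn_le _ _).2 (huc n), (Lp.coeFn_le _ _).2 (hvd n),
      (Lp.coeFn_nonneg _).2 (slopeLp_nonneg (u n)), (Lp.coeFn_nonneg _).2 (slopeLp_nonneg (v n)),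
      (Lp.coeFn_nonneg _).2 (slopeLp_nonneg (u n + v n)),
      (Lp.coeFn_nonneg _).2 (slopeLp_nonneg (u n - v n))] with x e1 e2 e3 e4 e5 e6 e7 e8
    refine ⟨e7, e8, e1.1, ?_⟩
    simp only [Pi.zero_apply] at e5 e6
    rw [e2, e1.2]
    gcongr
  obtain ⟨B, hB⟩ := hwlim.norm.bddAbove_range
  have hwB : ∀ n, ‖w n‖ ≤ B := fun n => hB ⟨n, rfl⟩
  have haB : ∀ n, ‖a n‖ ≤ B := fun n => by
    refine (Lp.norm_le_norm_of_ae_le ?_).trans (hwB n)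
    filter_upwards [hab n] with x ⟨e1, e2, e3, e4⟩
    rw [Real.norm_of_nonneg e1, Real.norm_of_nonneg e3]
    exact abs_le_of_sq_le_sq' (by nlinarith) e3 |>.2
  have hbB : ∀ n, ‖b n‖ ≤ B := fun n => by
    refine (Lp.norm_le_norm_of_ae_le ?_).trans (hwB n)
    filter_upwards [hab n] with x ⟨e1, e2, e3, e4⟩
    rw [Real.norm_of_nonneg e2, Real.norm_of_nonneg e3]
    exact abs_le_of_sq_le_sq' (by nlinarith) e3 |>.2
  set U := Filter.hyperfilter ℕ
  have hU : (U : Filter ℕ) ≤ atTop := Nat.hyperfilter_le_atTop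
  obtain ⟨A, hA⟩ := isReflexiveSpace_Lp.exists_tendsto_ultrafilter U haB
  obtain ⟨A', hA'⟩ := isReflexiveSpace_Lp.exists_tendsto_ultrafilter U hbB
  have hlin : ∀ i j : ℚ, (i : ℝ) • A + (j : ℝ) • A'
      ≤ √((i : ℝ) ^ 2 + (j : ℝ) ^ 2) • (√2 • N (G, H)) := by
    intro i j
    have hcone : Convex ℝ {h : Lp ℝ p m | 0 ≤ h} := by
      intro h hh k hk s t hs ht _
      exact add_nonneg (Lp_smul_nonneg hs hh) (Lp_smul_nonneg ht hk)
    have hcl : IsClosed {h : Lp ℝ p m | 0 ≤ h} := isClosed_le continuous_const continuous_id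
    have := mem_closure_of_tendsto_weakly hcone (l := (U : Filter ℕ))
      (a := fun n => √((i : ℝ) ^ 2 + (j : ℝ) ^ 2) • w n - ((i : ℝ) • a n + (j : ℝ) • b n))
      (x := √((i : ℝ) ^ 2 + (j : ℝ) ^ 2) • (√2 • N (G, H)) - ((i : ℝ) • A + (j : ℝ) • A'))
      (Eventually.of_forall fun n => ?_) fun φ => ?_
    · rwa [hcl.closure_eq, mem_ofPred_eq, sub_nonneg] at this
    · rw [mem_ofPred_eq, sub_nonneg, ← Lp.coeFn_le]
      filter_upwards [hab n, Lp.coeFn_add ((i : ℝ) • a n) ((j : ℝ) • b n),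
        Lp.coeFn_smul (i : ℝ) (a n), Lp.coeFn_smul (j : ℝ) (b n),
        Lp.coeFn_smul (√((i : ℝ) ^ 2 + (j : ℝ) ^ 2)) (w n)] with x ⟨_, _, e3, e4⟩ e5 e6 e7 e8
      rw [e5, e8, Pi.add_apply, e6, e7]
      simp only [Pi.smul_apply, smul_eq_mul]
      refine Real.le_sqrt_of_sq_le (y := ((i : ℝ) ^ 2 + (j : ℝ) ^ 2) * w n x ^ 2) ?_ |>.trans
        (le_of_eq ?_)
      · have : ((i : ℝ) * a n x + j * b n x) ^ 2
            ≤ ((i : ℝ) ^ 2 + (j : ℝ) ^ 2) * (a n x ^ 2 + b n x ^ 2) := by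
          nlinarith [sq_nonneg ((i : ℝ) * b n x - j * a n x)]
        refine this.trans ?_
        gcongr
      · rw [Real.sqrt_mul (by positivity), Real.sqrt_sq e3]
    · have hφw := (φ.continuous.tendsto _).comp (hwlim.mono_left hU)
      simp only [map_sub, map_add, map_smul φ (√((i : ℝ) ^ 2 + (j : ℝ) ^ 2)), map_smul φ (i : ℝ),
        map_smul φ (j : ℝ), smul_eq_mul]
      exact (hφw.const_mul _).sub (((hA φ).const_mul _).add ((hA' φ).const_mul _))
  have hae : ∀ᵐ x ∂m, ∀ i j : ℚ, (i : ℝ) * A x + j * A' x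
      ≤ √((i : ℝ) ^ 2 + (j : ℝ) ^ 2) * (√2 • N (G, H) : Lp ℝ p m) x := by
    rw [ae_all_iff]; intro i
    rw [ae_all_iff]; intro j
    filter_upwards [(Lp.coeFn_le _ _).2 (hlin i j), Lp.coeFn_add ((i : ℝ) • A) ((j : ℝ) • A'),
      Lp.coeFn_smul (i : ℝ) A, Lp.coeFn_smul (j : ℝ) A',
      Lp.coeFn_smul (√((i : ℝ) ^ 2 + (j : ℝ) ^ 2)) (√2 • N (G, H))] with x e1 e2 e3 e4 e5
    rwa [e2, e5, Pi.add_apply, e3, e4] at e1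
  filter_upwards [hae, hW G H,
    (Lp.coeFn_le _ _).2 (relaxedSlope_le_of_tendsto_weakly (f + g) _ hu' hU hA),
    (Lp.coeFn_le _ _).2 (relaxedSlope_le_of_tendsto_weakly (f - g) _ hv' hU hA'),
    (Lp.coeFn_nonneg _).2 (relaxedSlope_nonneg (f + g)),
    (Lp.coeFn_nonneg _).2 (relaxedSlope_nonneg (f - g))] with x e1 e2 e3 e4 e5 e6
  simp only [Pi.zero_apply] at e5 e6
  have := sq_add_sq_le_of_forall_rat e2.1 e1
  rw [e2.2] at this
  refine le_trans ?_ this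
  gcongr

theorem le_sq_of_isGreatest_lowerBounds {M : Type*} [MeasurableSpace M] {m : Measure M} {p : ℝ≥0∞}
    {S : Set (Lp ℝ p m)} (hne : S.Nonempty) (h0 : ∀ G ∈ S, 0 ≤ G) {D : Lp ℝ p m}
    (hD : IsGreatest (lowerBounds S) D) {T : M → ℝ} (hT : AEStronglyMeasurable T m)
    (hTS : ∀ G ∈ S, ∀ᵐ x ∂m, T x ≤ G x ^ 2) : ∀ᵐ x ∂m, T x ≤ D x ^ 2 := by
  have hle : ∀ G ∈ S, ∀ᵐ x ∂m, √(T x) ≤ G x := fun G hG => by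
    filter_upwards [hTS G hG, (Lp.coeFn_nonneg G).2 (h0 G hG)] with x e1 e2
    exact Real.sqrt_le_iff.2 ⟨e2, e1⟩
  obtain ⟨G₀, hG₀⟩ := hne
  have hmem : MemLp (fun x => √(T x)) p m := by
    refine (Lp.memLp G₀).mono (Real.continuous_sqrt.comp_aestronglyMeasurable hT) ?_
    filter_upwards [hle G₀ hG₀] with x e1
    rw [Real.norm_of_nonneg (Real.sqrt_nonneg _)]
    exact e1.trans (Real.le_norm_self _)
  have hR : hmem.toLp ≤ D := hD.2 fun G hG => by
    rw [← Lp.coeFn_le]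
    filter_upwards [hmem.coeFn_toLp, hle G hG] with x e1 e2
    rwa [e1]
  filter_upwards [hmem.coeFn_toLp, (Lp.coeFn_le _ _).2 hR] with x e1 e2
  rw [e1] at e2
  exact (Real.sqrt_le_left ((Real.sqrt_nonneg _).trans e2)).1 e2

/-- The pointwise parallelogram inequality for relaxed slopes. -/
theorem InfinitesimallyRiemannian.relaxedSlope_sq_add_sq_le (hR : InfinitesimallyRiemannian m)
    (f g : relaxedDomain m p) :
    ∀ᵐ x ∂m, relaxedSlope (f + g) x ^ 2 + relaxedSlope (f - g) x ^ 2
      ≤ 2 * relaxedSlope f x ^ 2 + 2 * relaxedSlope g x ^ 2 := by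
  set P : M → ℝ := fun x =>
    1 / 2 * (relaxedSlope (f + g) x ^ 2 + relaxedSlope (f - g) x ^ 2) with hP
  have hPm : AEStronglyMeasurable P m :=
    (((Lp.aestronglyMeasurable _).pow 2).add ((Lp.aestronglyMeasurable _).pow 2)).const_mul _
  have hf : ∀ H ∈ weakSlopeLimits m p g, ∀ᵐ x ∂m,
      P x - H x ^ 2 ≤ relaxedSlope f x ^ 2 := fun H hH => by
    refine le_sq_of_isGreatest_lowerBounds (weakSlopeLimits_nonempty f.2) weakSlopeLimits_nonneg
      (isGreatest_relaxedSlope f) (hPm.sub ((Lp.aestronglyMeasurable H).pow 2))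
      fun G hG => ?_
    filter_upwards [hR.relaxedSlope_sq_le_of_mem f g hG hH] with x hx
    simp only [hP]
    linarith
  have hg := le_sq_of_isGreatest_lowerBounds (weakSlopeLimits_nonempty g.2) weakSlopeLimits_nonneg
    (isGreatest_relaxedSlope g)
    (hPm.sub ((Lp.aestronglyMeasurable (relaxedSlope f)).pow 2))
    fun H hH => by
      filter_upwards [hf H hH] with x hx
      simp only [Pi.sub_apply, Pi.pow_apply]
      linarith
  filter_upwards [hg] with x hx
  simp only [Pi.sub_apply, Pi.pow_apply, hP] at hx
  linarith

end RelaxedParallelogram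

/-! ### The Cheeger energy -/

section Cheeger

variable {M : Type*} [MetricSpace M] [MeasurableSpace M] [BorelSpace M]
  {m : Measure M} [SigmaFinite m]

theorem cheegerEnergy_coe (f : relaxedDomain m 2) :
    cheegerEnergy m f = ∫⁻ x, ENNReal.ofReal (relaxedSlope f x ^ 2) ∂m := by
  rw [cheegerEnergy, dif_pos f.2]
  refine lintegral_congr_ae ?_
  filter_upwards [(Lp.coeFn_nonneg _).2 (relaxedSlope_nonneg f)] with x hx
  rw [ENNReal.ofReal_pow hx]

theorem cheegerEnergy_of_notMem {f : M →ₘ[m] ℝ} (hf : f ∉ relaxedDomain m 2) :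
    cheegerEnergy m f = ⊤ := dif_neg hf

theorem cheegerEnergy_coe_smul (c : ℝ) (f : relaxedDomain m 2) :
    cheegerEnergy m (c • (f : M →ₘ[m] ℝ)) = ENNReal.ofReal (c ^ 2) * cheegerEnergy m f := by
  rw [← Submodule.coe_smul, cheegerEnergy_coe, cheegerEnergy_coe,
    ← lintegral_const_mul' _ _ ENNReal.ofReal_ne_top]
  refine lintegral_congr_ae ?_
  rw [relaxedSlope_smul]
  filter_upwards [Lp.coeFn_smul |c| (relaxedSlope f)] with x hx
  rw [hx, Pi.smul_apply, smul_eq_mul, mul_pow, sq_abs, ENNReal.ofReal_mul (sq_nonneg c)]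

theorem cheegerEnergy_smul (c : ℝ) (f : M →ₘ[m] ℝ) :
    cheegerEnergy m (c • f) = ENNReal.ofReal (c ^ 2) * cheegerEnergy m f := by
  by_cases hf : f ∈ relaxedDomain m 2
  · exact cheegerEnergy_coe_smul c ⟨f, hf⟩
  rcases eq_or_ne c 0 with rfl | hc
  · have := cheegerEnergy_coe_smul 0 (0 : relaxedDomain m 2)
    rw [zero_smul] at this ⊢
    rw [ZeroMemClass.coe_zero, sq, zero_mul, ENNReal.ofReal_zero, zero_mul] at this
    rw [this, sq, zero_mul, ENNReal.ofReal_zero, zero_mul]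
  · have hcf : c • f ∉ relaxedDomain m 2 := fun h =>
      hf ((Submodule.smul_mem_iff _ hc).1 h)
    rw [cheegerEnergy_of_notMem hf, cheegerEnergy_of_notMem hcf, ENNReal.mul_top]
    have : 0 < c ^ 2 := by positivity
    simpa using hc

theorem InfinitesimallyRiemannian.cheegerEnergy_add_le (hR : InfinitesimallyRiemannian m)
    (f g : relaxedDomain m 2) :
    cheegerEnergy m (f + g : M →ₘ[m] ℝ) + cheegerEnergy m (f - g : M →ₘ[m] ℝ)
      ≤ 2 * cheegerEnergy m f + 2 * cheegerEnergy m g := by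
  have hm : ∀ h : relaxedDomain m 2,
      AEMeasurable (fun x => ENNReal.ofReal (relaxedSlope h x ^ 2)) m := fun h =>
    ((Lp.aestronglyMeasurable _).aemeasurable.pow_const 2).ennreal_ofReal
  rw [← Submodule.coe_add, ← Submodule.coe_sub]
  simp only [cheegerEnergy_coe]
  rw [← lintegral_add_left' (hm _), ← lintegral_const_mul' _ _ ENNReal.ofNat_ne_top,
    ← lintegral_const_mul' _ _ ENNReal.ofNat_ne_top, ← lintegral_add_left' ((hm _).const_mul 2)]
  refine lintegral_mono_ae ?_
  filter_upwards [hR.relaxedSlope_sq_add_sq_le f g] with x hx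
  have h2 : ∀ t : ℝ, 2 * ENNReal.ofReal t = ENNReal.ofReal (2 * t) := fun t => by
    rw [ENNReal.ofReal_mul zero_le_two, ENNReal.ofReal_ofNat]
  rw [← ENNReal.ofReal_add (sq_nonneg _) (sq_nonneg _), h2, h2,
    ← ENNReal.ofReal_add (by positivity) (by positivity)]
  exact ENNReal.ofReal_le_ofReal hx

theorem InfinitesimallyRiemannian.cheegerEnergy_parallelogram (hR : InfinitesimallyRiemannian m)
    (f g : relaxedDomain m 2) :
    cheegerEnergy m (f + g : M →ₘ[m] ℝ) + cheegerEnergy m (f - g : M →ₘ[m] ℝ)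
      = 2 * cheegerEnergy m f + 2 * cheegerEnergy m g := by
  refine le_antisymm (hR.cheegerEnergy_add_le f g) ?_
  have h := hR.cheegerEnergy_add_le (f + g) (f - g)
  rw [Submodule.coe_add, Submodule.coe_sub, add_add_sub_cancel, add_sub_sub_cancel,
    ← two_smul ℝ (f : M →ₘ[m] ℝ), ← two_smul ℝ (g : M →ₘ[m] ℝ), cheegerEnergy_smul,
    cheegerEnergy_smul, sq, ENNReal.ofReal_mul zero_le_two, ENNReal.ofReal_ofNat, mul_assoc,
    mul_assoc, ← mul_add, ← mul_add, ← mul_add] at h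
  rw [← mul_add]
  exact (ENNReal.mul_le_mul_iff_right two_ne_zero ENNReal.ofNat_ne_top).1 h

theorem InfinitesimallyRiemannian.infinitesimallyHilbertian (hR : InfinitesimallyRiemannian m) :
    InfinitesimallyHilbertian m := by
  refine ⟨fun f g => ?_, cheegerEnergy_smul⟩
  by_cases hfg : f ∈ relaxedDomain m 2 ∧ g ∈ relaxedDomain m 2
  · exact hR.cheegerEnergy_parallelogram ⟨f, hfg.1⟩ ⟨g, hfg.2⟩
  have hsum : ¬ (f + g ∈ relaxedDomain m 2 ∧ f - g ∈ relaxedDomain m 2) := fun ⟨h1, h2⟩ => by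
    refine hfg ⟨?_, ?_⟩
    · have := add_mem h1 h2
      rwa [add_add_sub_cancel, ← two_smul ℝ, Submodule.smul_mem_iff _ two_ne_zero] at this
    · have := sub_mem h1 h2
      rwa [add_sub_sub_cancel, ← two_smul ℝ, Submodule.smul_mem_iff _ two_ne_zero] at this
  have hl : cheegerEnergy m (f + g) + cheegerEnergy m (f - g) = ⊤ := by
    rw [not_and_or] at hsum
    rcases hsum with h | h <;> simp [cheegerEnergy_of_notMem h]
  have hr : 2 * cheegerEnergy m f + 2 * cheegerEnergy m g = ⊤ := by
    rw [not_and_or] at hfg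
    rcases hfg with h | h <;> simp [cheegerEnergy_of_notMem h]
  rw [hl, hr]

end Cheeger

end MetricSobolev

theorem mainTheorem10 {M : Type*} [MetricSpace M] [CompleteSpace M] [MeasurableSpace M]
    [BorelSpace M] (m : Measure M) [m.Regular] [MetricSobolev.FiniteOnBounded m]
    (hR : MetricSobolev.InfinitesimallyRiemannian m) :
    MetricSobolev.InfinitesimallyHilbertian m ∧
      ∀ (p : ℝ≥0∞) [Fact (1 < p)] [Fact (p < ⊤)],
        MetricSobolev.IsReflexiveSpace (MetricSobolev.CotangentModule m p) :=
  ⟨hR.infinitesimallyHilbertian, fun p _ _ =>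
    (MetricSobolev.relaxedFunctional m p).isReflexiveSpace_generatedModule
      hR.relaxedSlope_sq_add_sq_le⟩
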